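/- Let $S$ be a (not necessarily commutative) ring and let $A=\bigoplus_{n\ge 0}A^n$ be a graded $S$-ring (a graded ring with a ring morphism from $S$) that is connected ($A^0=S$) and strongly graded ($A^nA^m=A^{n+m}$ for all $n,m$). Let $T_A=T_S(A^1)$ be the tensor ring of the $S$-bimodule $A^1$, graded by $T_A^n=(A^1)^{\otimes_S n}$, let $\pi_A:T_A\to A$ be the canonical morphism of $S$-rings and let $I_A=\ker\pi_A$. Let $R\subseteq T_A$ be a bimodule of relations for $A$, i.e. a graded $S$-subbimodule with $R\oplus(A^1I_A+I_AA^1)=I_A$, and suppose that $R$ and $A^1$ are projective as left $S$-modules. Let $\alpha:R\to T_A$ be a filtered map, i.e. a morphism of $S$-bimodules such that $\alpha(R^n)\subseteq\bigoplus_{m\le n}T_A^m$ for all $n$ and such that the degree $n$ component of $\alpha(r)$ is $r$ for $r\in R^n$. For $r\in R^n$ let $\alpha_i(r)$ be the component of degree $n-i$ of $\alpha(r)$, extend $\alpha_i$ additively to $R$, and put $\alpha_z(r)=\sum_{i\ge 0}\alpha_i(r)z^i\in T_A[z]$, where $z$ is a central indeterminate of degree $1$. The central extension associated to $\alpha$ is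 the graded ring $D=T_A[z]/\langle\alpha_z(R)\rangle$; the class of $z$ in $D$ is again denoted by $z$. For $c\in\mathbb Z\cup\{\infty\}$, the element $z$ is called $c$-regular if the annihilator of $z$ in $D$ has no nonzero homogeneous element of degree at most $c$; it is called regular if it is not a zero divisor in $D$, i.e. if its annihilator is $0$. Let $$\cdots\to A\otimes_S V_4\xrightarrow{d_4} A\otimes_S V_3\xrightarrow{d_3}A\otimes_S V_2\xrightarrow{d_2}A\otimes_S A^1\xrightarrow{d_1}A\xrightarrow{d_0}S\to 0$$ be any exact sequence of graded left $A$-modules and graded morphisms in which $d_0$ is the projection onto $A^0$, $d_1$ is induced by the multiplication of $A$, every $V_n$ ($n\ge 2$) is an $\mathbb N$-graded left $S$-module that is projective over $S$, and $V_n^0=V_n^1=0$ for all $n\ge 3$. Let $c_{V_3}=-1$ if $V_3=0$, and $c_{V_3}=\sup\{n-1\mid V_3^n\neq 0\}\in\mathbb Z\cup\{\infty\}$ otherwise. Then $z$ is regular in $D$ if and only if either $c_{V_3}=-1$ or $z$ is $c_{V_3}$-regular. -/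

import Mathlib

open scoped TensorProduct

/-! An `S`-ring over a (possibly noncommutative) ring `S` is a ring `A` with a ring morphism
`S → A`.  It is encoded by `[Module S A] [IsScalarTower S A A]`: the morphism is `s ↦ s • 1`
(this is `RingHom.smulOneHom`), the left action of `S` is `s • a = (s • 1) * a` and the right
action is `a * (s • 1)`. -/

namespace SRing

universe u v w

/-! ### Tensor rings -/

section TensorRing

/-- The defining relations of the tensor ring of an `S`-bimodule `V`, on the free ring with
one generator for each element of `S` and one for each element of `V`. -/
inductive TensorRel (S : Type u) (V : Type v) [Ring S] [AddCommGroup V] [Module S V]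
    [Module Sᵐᵒᵖ V] : FreeAlgebra ℤ (S ⊕ V) → FreeAlgebra ℤ (S ⊕ V) → Prop
  | scalar_one : TensorRel S V (FreeAlgebra.ι ℤ (Sum.inl 1)) 1
  | scalar_add (s t : S) : TensorRel S V (FreeAlgebra.ι ℤ (Sum.inl (s + t)))
      (FreeAlgebra.ι ℤ (Sum.inl s) + FreeAlgebra.ι ℤ (Sum.inl t))
  | scalar_mul (s t : S) : TensorRel S V (FreeAlgebra.ι ℤ (Sum.inl (s * t)))
      (FreeAlgebra.ι ℤ (Sum.inl s) * FreeAlgebra.ι ℤ (Sum.inl t))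
  | vec_add (x y : V) : TensorRel S V (FreeAlgebra.ι ℤ (Sum.inr (x + y)))
      (FreeAlgebra.ι ℤ (Sum.inr x) + FreeAlgebra.ι ℤ (Sum.inr y))
  | vec_left (s : S) (x : V) : TensorRel S V (FreeAlgebra.ι ℤ (Sum.inr (s • x)))
      (FreeAlgebra.ι ℤ (Sum.inl s) * FreeAlgebra.ι ℤ (Sum.inr x))
  | vec_right (s : S) (x : V) : TensorRel S V (FreeAlgebra.ι ℤ (Sum.inr (MulOpposite.op s • x)))
      (FreeAlgebra.ι ℤ (Sum.inr x) * FreeAlgebra.ι ℤ (Sum.inl s))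

/-- The tensor ring `T_S(V)` of an `S`-bimodule `V`: the universal ring with a ring morphism
from `S` and an `S`-bimodule morphism from `V` (see `TensorRing.lift`, `TensorRing.hom_ext`). -/
def TensorRing (S : Type u) (V : Type v) [Ring S] [AddCommGroup V] [Module S V]
    [Module Sᵐᵒᵖ V] : Type (max u v) :=
  RingQuot (TensorRel S V)

namespace TensorRing

variable (S : Type u) (V : Type v) [Ring S] [AddCommGroup V] [Module S V] [Module Sᵐᵒᵖ V]

noncomputable instance : Ring (TensorRing S V) :=
  inferInstanceAs (Ring (RingQuot (TensorRel S V)))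

/-- The quotient map from the free ring. -/
noncomputable def mk : FreeAlgebra ℤ (S ⊕ V) →+* TensorRing S V :=
  RingQuot.mkRingHom (TensorRel S V)

variable {S V} in
theorem mk_rel {x y : FreeAlgebra ℤ (S ⊕ V)} (h : TensorRel S V x y) : mk S V x = mk S V y :=
  RingQuot.mkRingHom_rel h

/-- The structure morphism `S → T_S(V)`. -/
noncomputable def scalar : S →+* TensorRing S V where
  toFun s := mk S V (FreeAlgebra.ι ℤ (Sum.inl s))
  map_one' := by rw [mk_rel .scalar_one, map_one]
  map_mul' s t := by rw [mk_rel (.scalar_mul s t), map_mul]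
  map_add' s t := by rw [mk_rel (.scalar_add s t), map_add]
  map_zero' := by
    have h := mk_rel (TensorRel.scalar_add (V := V) (0 : S) 0)
    rw [add_zero, map_add] at h
    exact left_eq_add.mp h

noncomputable instance : Module S (TensorRing S V) := Module.compHom _ (scalar S V)

variable {S V} in
theorem smul_def (s : S) (t : TensorRing S V) : s • t = scalar S V s * t := rfl

instance : IsScalarTower S (TensorRing S V) (TensorRing S V) :=
  ⟨fun s x y => by simp only [smul_def, smul_eq_mul, mul_assoc]⟩

/-- The canonical map `V → T_S(V)`. -/
noncomputable def ι : V →ₗ[S] TensorRing S V where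
  toFun x := mk S V (FreeAlgebra.ι ℤ (Sum.inr x))
  map_add' x y := by rw [mk_rel (.vec_add x y), map_add]
  map_smul' s x := by
    rw [mk_rel (.vec_left s x), map_mul]
    rfl

variable {S V}

theorem ι_op_smul (s : S) (x : V) :
    ι S V (MulOpposite.op s • x) = ι S V x * scalar S V s := by
  change mk S V _ = mk S V _ * mk S V _
  rw [mk_rel (.vec_right s x), map_mul]

/-- The universal property of the tensor ring: existence. -/
noncomputable def lift {B : Type w} [Ring B] (f : S →+* B) (g : V →+ B)
    (hl : ∀ s x, g (s • x) = f s * g x) (hr : ∀ s x, g (MulOpposite.op s • x) = g x * f s) :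
    TensorRing S V →+* B :=
  RingQuot.lift ⟨(FreeAlgebra.lift ℤ (Sum.elim f g)).toRingHom, by
    rintro _ _ (_ | _ | _ | _ | _ | _) <;> simp [hl, hr]⟩

section
variable {B : Type w} [Ring B] (f : S →+* B) (g : V →+ B)
    (hl : ∀ s x, g (s • x) = f s * g x) (hr : ∀ s x, g (MulOpposite.op s • x) = g x * f s)

theorem lift_scalar (s : S) : lift f g hl hr (scalar S V s) = f s := by
  change RingQuot.lift _ (RingQuot.mkRingHom _ _) = _
  rw [RingQuot.lift_mkRingHom_apply]
  simp

theorem lift_ι (x : V) : lift f g hl hr (ι S V x) = g x := by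
  change RingQuot.lift _ (RingQuot.mkRingHom _ _) = _
  rw [RingQuot.lift_mkRingHom_apply]
  simp
end

/-- The universal property of the tensor ring: uniqueness. -/
theorem hom_ext {B : Type w} [Ring B] {f g : TensorRing S V →+* B}
    (h₀ : ∀ s, f (scalar S V s) = g (scalar S V s)) (h₁ : ∀ x, f (ι S V x) = g (ι S V x)) :
    f = g := by
  apply RingQuot.ringQuot_ext
  have : (f.comp (mk S V)).toIntAlgHom = (g.comp (mk S V)).toIntAlgHom := by
    apply FreeAlgebra.hom_ext
    funext i
    rcases i with s | x
    · exact h₀ s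
    · exact h₁ x
  exact RingHom.ext fun x => DFunLike.congr_fun this x

variable (S V)

/-- The homogeneous components of `T_S(V)`: `T⁰` is the image of `S` and `Tⁿ⁺¹ = Tⁿ V`. -/
noncomputable def deg : ℕ → Submodule S (TensorRing S V)
  | 0 => Submodule.span S {1}
  | n + 1 => Submodule.span S {x | ∃ t ∈ deg n, ∃ y : V, x = t * ι S V y}

variable {S V}

theorem scalar_mem (s : S) : scalar S V s ∈ deg S V 0 :=
  Submodule.mem_span_singleton.mpr ⟨s, by rw [smul_def, mul_one]⟩

theorem mul_ι_mem {n : ℕ} {t : TensorRing S V} (ht : t ∈ deg S V n) (y : V) :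
    t * ι S V y ∈ deg S V (n + 1) :=
  Submodule.subset_span ⟨t, ht, y, rfl⟩

theorem ι_mem (x : V) : ι S V x ∈ deg S V 1 := by
  simpa using mul_ι_mem (scalar_mem (V := V) (1 : S)) x

theorem mul_scalar_mem {n : ℕ} {t : TensorRing S V} (ht : t ∈ deg S V n) (s : S) :
    t * scalar S V s ∈ deg S V n := by
  cases n with
  | zero =>
    obtain ⟨r, rfl⟩ := Submodule.mem_span_singleton.mp ht
    rw [smul_def, mul_one, ← map_mul]
    exact scalar_mem _
  | succ n =>
    rw [deg] at ht
    induction ht using Submodule.span_induction with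
    | mem x hx =>
      obtain ⟨t, ht, y, rfl⟩ := hx
      rw [mul_assoc, ← ι_op_smul]
      exact mul_ι_mem ht _
    | zero => simp
    | add x y _ _ hx hy =>
      rw [add_mul]
      exact add_mem hx hy
    | smul r x _ hx =>
      rw [smul_mul_assoc]
      exact Submodule.smul_mem _ _ hx

instance : SetLike.GradedMonoid (deg S V) where
  one_mem := Submodule.subset_span rfl
  mul_mem := by
    intro i j a b ha hb
    induction j generalizing a b with
    | zero =>
      obtain ⟨r, rfl⟩ := Submodule.mem_span_singleton.mp hb
      rw [smul_def, mul_one]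
      exact mul_scalar_mem ha r
    | succ j ih =>
      rw [deg] at hb
      induction hb using Submodule.span_induction generalizing a with
      | mem x hx =>
        obtain ⟨t, ht, y, rfl⟩ := hx
        rw [← mul_assoc]
        exact mul_ι_mem (ih ha ht) y
      | zero => simp
      | add x y _ _ hx hy =>
        rw [mul_add]
        exact add_mem (hx ha) (hy ha)
      | smul r x _ hx =>
        rw [smul_def, ← mul_assoc]
        exact hx (mul_scalar_mem ha r)

open DirectSum in
/-- The structure morphism of `⨁ Tⁿ`. -/
noncomputable def scalarSum : S →+* ⨁ n, deg S V n where
  toFun s := DirectSum.of (fun n => deg S V n) 0 ⟨scalar S V s, scalar_mem s⟩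
  map_one' := by
    rw [DirectSum.one_def]
    congr 1
    exact Subtype.ext (map_one _)
  map_mul' s t := by
    rw [DirectSum.of_mul_of]
    refine DirectSum.of_eq_of_gradedMonoid_eq (Sigma.subtype_ext (add_zero 0).symm ?_)
    exact map_mul _ _ _
  map_add' s t := by
    rw [← map_add]
    congr 1
    exact Subtype.ext (map_add _ _ _)
  map_zero' := by
    rw [← map_zero (DirectSum.of (fun n => deg S V n) 0)]
    congr 1
    exact Subtype.ext (map_zero _)

open DirectSum in
/-- The canonical map `V → ⨁ Tⁿ`. -/
noncomputable def ιSum : V →+ ⨁ n, deg S V n :=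
  (DirectSum.of (fun n => deg S V n) 1).comp
    ((ι S V).toAddMonoidHom.codRestrict (deg S V 1) fun x => ι_mem x)

open DirectSum in
/-- The decomposition of an element of `T_S(V)` into its homogeneous components. -/
noncomputable def split : TensorRing S V →+* ⨁ n, deg S V n :=
  lift scalarSum ιSum
    (fun s x => by
      change DirectSum.of (fun n => deg S V n) 1 _ = DirectSum.of (fun n => deg S V n) 0 _ *
        DirectSum.of (fun n => deg S V n) 1 _
      rw [DirectSum.of_mul_of]
      refine DirectSum.of_eq_of_gradedMonoid_eq (Sigma.subtype_ext (zero_add 1).symm ?_)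
      exact (ι S V).map_smul s x)
    (fun s x => by
      change DirectSum.of (fun n => deg S V n) 1 _ = DirectSum.of (fun n => deg S V n) 1 _ *
        DirectSum.of (fun n => deg S V n) 0 _
      rw [DirectSum.of_mul_of]
      refine DirectSum.of_eq_of_gradedMonoid_eq (Sigma.subtype_ext (add_zero 1).symm ?_)
      exact ι_op_smul s x)

theorem split_smul_of {n : ℕ} (s : S) (x : TensorRing S V) (hx : x ∈ deg S V n)
    (h : split x = DirectSum.of (fun n => deg S V n) n ⟨x, hx⟩) :
    split (s • x) =
      DirectSum.of (fun n => deg S V n) n ⟨s • x, Submodule.smul_mem _ s hx⟩ := by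
  have h₀ : split (scalar S V s) =
      DirectSum.of (fun n => deg S V n) 0 ⟨scalar S V s, scalar_mem s⟩ := lift_scalar _ _ _ _ _
  have h₁ : split (s • x) = split (scalar S V s) * split x := map_mul _ _ _
  rw [h₁, h, h₀, DirectSum.of_mul_of]
  exact DirectSum.of_eq_of_gradedMonoid_eq (Sigma.subtype_ext (zero_add n) rfl)

theorem split_of_mem {n : ℕ} (x : TensorRing S V) (hx : x ∈ deg S V n) :
    split x = DirectSum.of (fun n => deg S V n) n ⟨x, hx⟩ := by
  induction n generalizing x with
  | zero =>
    have hx' := hx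
    obtain ⟨r, rfl⟩ := Submodule.mem_span_singleton.mp hx'
    exact split_smul_of r 1 SetLike.GradedOne.one_mem (map_one _)
  | succ n ih =>
    have hx' : x ∈ Submodule.span S {x | ∃ t ∈ deg S V n, ∃ y : V, x = t * ι S V y} := hx
    revert hx
    induction hx' using Submodule.span_induction with
    | mem x h =>
      intro hx
      obtain ⟨t, ht, y, rfl⟩ := h
      rw [map_mul, ih t ht]
      have : split (ι S V y) = DirectSum.of (fun n => deg S V n) 1 ⟨ι S V y, ι_mem y⟩ :=
        lift_ι _ _ _ _ _
      rw [this, DirectSum.of_mul_of]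
      rfl
    | zero =>
      intro hx
      rw [map_zero]
      exact (map_zero (DirectSum.of (fun n => deg S V n) (n + 1))).symm
    | add x y h₁ h₂ h₃ h₄ =>
      intro hx
      rw [map_add, h₃ h₁, h₄ h₂, ← map_add]
      rfl
    | smul r x h₁ h₂ => exact fun _ => split_smul_of (n := n + 1) r x h₁ (h₂ h₁)

noncomputable instance : DirectSum.Decomposition (deg S V) where
  decompose' := split
  left_inv x := by
    have : (DirectSum.coeRingHom (deg S V)).comp split = RingHom.id _ := by
      apply hom_ext
      · intro s
        rw [RingHom.comp_apply, split, lift_scalar]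
        exact DirectSum.coeRingHom_of (deg S V) 0 _
      · intro x
        rw [RingHom.comp_apply, split, lift_ι]
        exact DirectSum.coeRingHom_of (deg S V) 1 _
    exact DFunLike.congr_fun this x
  right_inv x := by
    induction x using DirectSum.induction_on with
    | zero => simp
    | of n x =>
      rw [DirectSum.coeAddMonoidHom_of]
      exact split_of_mem x.1 x.2
    | add x y hx hy => rw [map_add, map_add, hx, hy]

noncomputable instance : GradedRing (deg S V) where

end TensorRing

end TensorRing

/-! ### Connected strongly graded `S`-rings -/

section Graded

variable {S : Type u} {A : Type v} [Ring S] [Ring A] [Module S A] [IsScalarTower S A A]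

/-- `A` is connected: the structure morphism `s ↦ s • 1` is a bijection of `S` onto `A⁰`. -/
def IsConnectedGrading (𝒜 : ℕ → Submodule S A) : Prop :=
  Function.Injective (fun s : S => s • (1 : A)) ∧ Set.range (fun s : S => s • (1 : A)) = 𝒜 0

/-- `A` is strongly graded: `Aⁿ Aᵐ = Aⁿ⁺ᵐ` for all `n` and `m`, where `Aⁿ Aᵐ` is the set of all
finite sums of products. -/
def IsStronglyGraded (𝒜 : ℕ → Submodule S A) : Prop :=
  ∀ n m : ℕ, AddSubgroup.closure {x : A | ∃ a ∈ 𝒜 n, ∃ b ∈ 𝒜 m, x = a * b} =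
    (𝒜 (n + m)).toAddSubgroup

variable (𝒜 : ℕ → Submodule S A)

/-- The component `A¹` as an `S`-bimodule. -/
def DegOne : Type v := 𝒜 1

instance : AddCommGroup (DegOne 𝒜) := inferInstanceAs (AddCommGroup (𝒜 1))

instance : Module S (DegOne 𝒜) := inferInstanceAs (Module S (𝒜 1))

/-- The inclusion of `A¹` into `A`. -/
def DegOne.incl : DegOne 𝒜 →ₗ[S] A := (𝒜 1).subtype

section
variable [GradedRing 𝒜]

set_option linter.unusedSectionVars false in
theorem mul_smul_one_mem {n : ℕ} {a : A} (ha : a ∈ 𝒜 n) (s : S) : a * (s • 1) ∈ 𝒜 n := by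
  have h : s • (1 : A) ∈ 𝒜 0 := Submodule.smul_mem _ _ SetLike.GradedOne.one_mem
  simpa using SetLike.GradedMul.mul_mem ha h

/-- The right action of `S` on `A¹` is `x ↦ x * (s • 1)`. -/
instance : Module Sᵐᵒᵖ (DegOne 𝒜) where
  smul s x := (⟨DegOne.incl 𝒜 x * (s.unop • 1), mul_smul_one_mem 𝒜 x.2 _⟩ : 𝒜 1)
  one_smul x := Subtype.ext (by
    change DegOne.incl 𝒜 x * ((1 : S) • 1) = DegOne.incl 𝒜 x
    rw [one_smul, mul_one])
  mul_smul s t x := Subtype.ext (by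
    change DegOne.incl 𝒜 x * ((t.unop * s.unop) • 1) =
      DegOne.incl 𝒜 x * (t.unop • 1) * (s.unop • 1)
    rw [mul_assoc, smul_one_mul, mul_smul])
  smul_zero s := Subtype.ext (zero_mul _)
  smul_add s x y := Subtype.ext (add_mul _ _ _)
  add_smul s t x := Subtype.ext (by
    change DegOne.incl 𝒜 x * ((s.unop + t.unop) • 1) =
      DegOne.incl 𝒜 x * (s.unop • 1) + DegOne.incl 𝒜 x * (t.unop • 1)
    rw [add_smul, mul_add])
  zero_smul x := Subtype.ext (by
    change DegOne.incl 𝒜 x * ((0 : S) • 1) = 0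
    rw [zero_smul, mul_zero])

theorem DegOne.incl_op_smul (s : S) (x : DegOne 𝒜) :
    DegOne.incl 𝒜 (MulOpposite.op s • x) = DegOne.incl 𝒜 x * (s • 1) := rfl

/-- The tensor ring `T_A = T_S(A¹)`. -/
abbrev TA : Type (max u v) := TensorRing S (DegOne 𝒜)

/-- The canonical ring morphism `π_A : T_A → A`. -/
noncomputable def piA : TA 𝒜 →+* A :=
  TensorRing.lift RingHom.smulOneHom (DegOne.incl 𝒜).toAddMonoidHom
    (fun s x => by
      change DegOne.incl 𝒜 (s • x) = s • 1 * DegOne.incl 𝒜 x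
      rw [map_smul, smul_one_mul])
    (fun s x => DegOne.incl_op_smul 𝒜 s x)

/-- The kernel `I_A` of `π_A`. -/
noncomputable def relIdeal : Submodule S (TA 𝒜) :=
  (RingHom.ker (piA 𝒜)).restrictScalars S

/-- The subbimodule `A¹ I_A + I_A A¹` of `I_A`. -/
noncomputable def relIdealTilde : Submodule S (TA 𝒜) :=
  Submodule.span S {x | ∃ a : DegOne 𝒜, ∃ t ∈ relIdeal 𝒜, x = TensorRing.ι S _ a * t} ⊔
    Submodule.span S {x | ∃ a : DegOne 𝒜, ∃ t ∈ relIdeal 𝒜, x = t * TensorRing.ι S _ a}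

end

end Graded

/-! ### Graded subbimodules of a tensor ring, filtered maps and central extensions -/

section Extension

/-- A graded `S`-subbimodule of `T_S(V)`. -/
structure GradedSubbimodule (S : Type u) (V : Type v) [Ring S] [AddCommGroup V] [Module S V]
    [Module Sᵐᵒᵖ V] extends Submodule S (TensorRing S V) where
  mul_scalar_mem' : ∀ r ∈ carrier, ∀ s : S, r * TensorRing.scalar S V s ∈ carrier
  component_mem' : ∀ r ∈ carrier, ∀ n : ℕ,
    (DirectSum.decompose (TensorRing.deg S V) r n : TensorRing S V) ∈ carrier

/-- `R` is a bimodule of relations for `A`: one has `R ⊕ (A¹ I_A + I_A A¹) = I_A`. -/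
def IsBimoduleOfRelations {S : Type u} {A : Type v} [Ring S] [Ring A] [Module S A]
    [IsScalarTower S A A] (𝒜 : ℕ → Submodule S A) [GradedRing 𝒜]
    (R : GradedSubbimodule S (DegOne 𝒜)) : Prop :=
  R.toSubmodule ⊓ relIdealTilde 𝒜 = ⊥ ∧ R.toSubmodule ⊔ relIdealTilde 𝒜 = relIdeal 𝒜

variable {S : Type u} {V : Type v} [Ring S] [AddCommGroup V] [Module S V] [Module Sᵐᵒᵖ V]

/-- A morphism of filtered `S`-bimodules `α : R → T_S(V)`, that is, `α (Rⁿ) ⊆ T^{≤ n}`, whose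
component of degree `0` is the inclusion of `R`. -/
structure FilteredMap (R : GradedSubbimodule S V) extends
    R.toSubmodule →ₗ[S] TensorRing S V where
  map_right' : ∀ (r : R.toSubmodule) (s : S),
    toFun ⟨r * TensorRing.scalar S V s, R.mul_scalar_mem' r r.2 s⟩ =
      toFun r * TensorRing.scalar S V s
  filtered' : ∀ (n : ℕ) (r : R.toSubmodule), (r : TensorRing S V) ∈ TensorRing.deg S V n →
    toFun r ∈ ⨆ m ∈ Set.Iic n, TensorRing.deg S V m
  leading' : ∀ (n : ℕ) (r : R.toSubmodule), (r : TensorRing S V) ∈ TensorRing.deg S V n →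
    (DirectSum.decompose (TensorRing.deg S V) (toFun r) n : TensorRing S V) = r

variable {R : GradedSubbimodule S V} (α : FilteredMap R)

/-- The component `rₙ` of degree `n` of `r ∈ R`. -/
noncomputable def GradedSubbimodule.component (n : ℕ) (r : R.toSubmodule) : R.toSubmodule :=
  ⟨DirectSum.decompose (TensorRing.deg S V) (r : TensorRing S V) n, R.component_mem' r r.2 n⟩

open Classical in
/-- The map `α_z : R → T_S(V)[z]`, `α_z(r) = ∑ᵢ αᵢ(r) zⁱ`.  Here `αᵢ` is the component of degree
`-i` of `α`: on elements of degree `n` it is the component of degree `n - i` of `α`. -/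
noncomputable def FilteredMap.alphaZ (r : R.toSubmodule) : Polynomial (TensorRing S V) :=
  ∑ n ∈ (DirectSum.decompose (TensorRing.deg S V) (r : TensorRing S V)).support,
    ∑ i ∈ Finset.range (n + 1),
      Polynomial.C (DirectSum.decompose (TensorRing.deg S V)
        (α.toLinearMap (GradedSubbimodule.component n r)) (n - i) : TensorRing S V) *
        Polynomial.X ^ i

/-- The two-sided ideal of `T_S(V)[z]` generated by `α_z(R)`. -/
noncomputable def FilteredMap.extIdeal : TwoSidedIdeal (Polynomial (TensorRing S V)) :=
  TwoSidedIdeal.span (Set.range α.alphaZ)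

/-- The central extension `D = T_S(V)[z] / ⟨α_z(R)⟩` associated to `α`. -/
abbrev FilteredMap.D : Type (max u v) := α.extIdeal.ringCon.Quotient

/-- The class of the indeterminate in `D`. -/
noncomputable def FilteredMap.z : α.D := α.extIdeal.ringCon.mk' Polynomial.X

/-- The homogeneous component `Dⁿ`: the image of `∑ᵢ Tⁱ zⁿ⁻ⁱ`. -/
noncomputable def FilteredMap.degD (n : ℕ) : AddSubgroup α.D :=
  AddSubgroup.closure {d | ∃ i j : ℕ, i + j = n ∧ ∃ t ∈ TensorRing.deg S V i,
    d = α.extIdeal.ringCon.mk' (Polynomial.C t * Polynomial.X ^ j)}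

/-- The element `z` is `c`-regular: the homogeneous components of degree at most `c` of the
annihilator of `z` in `D` are trivial. -/
def FilteredMap.IsRegularUpTo (c : EReal) : Prop :=
  ∀ n : ℕ, (n : EReal) ≤ c → ∀ d ∈ α.degD n, α.z * d = 0 → d = 0

end Extension

/-! ### Tensor products `A ⊗_S V` and projective resolutions of `S` -/

section Resolution

/-- The tensor product `A ⊗_S V` of an `S`-ring `A` and a left `S`-module `V`, as a left
`A`-module: the quotient of `A ⊗_ℤ V` by the relations `a s ⊗ v = a ⊗ s v`. -/
abbrev TensorOver (S : Type u) (A : Type v) (V : Type w) [Ring S] [Ring A] [Module S A]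
    [IsScalarTower S A A] [AddCommGroup V] [Module S V] : Type (max v w) :=
  (A ⊗[ℤ] V) ⧸ Submodule.span A
    {x : A ⊗[ℤ] V | ∃ (a : A) (s : S) (v : V), x = (a * (s • 1)) ⊗ₜ[ℤ] v - a ⊗ₜ[ℤ] (s • v)}

variable {S : Type u} {A : Type v} [Ring S] [Ring A] [Module S A] [IsScalarTower S A A]

/-- The element `a ⊗ v` of `A ⊗_S V`. -/
def tmul (S : Type u) {A : Type v} {V : Type w} [Ring S] [Ring A] [Module S A]
    [IsScalarTower S A A] [AddCommGroup V] [Module S V] (a : A) (v : V) : TensorOver S A V :=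
  Submodule.Quotient.mk (a ⊗ₜ[ℤ] v)

/-- The component of degree `n` of `A ⊗_S V`, spanned by all `a ⊗ v` with `a ∈ Aⁱ`, `v ∈ Vʲ` and
`i + j = n`. -/
def tensorDeg (𝒜 : ℕ → Submodule S A) {V : Type w} [AddCommGroup V] [Module S V]
    (𝒱 : ℕ → Submodule S V) (n : ℕ) : AddSubgroup (TensorOver S A V) :=
  AddSubgroup.closure {x | ∃ i j : ℕ, i + j = n ∧ ∃ a ∈ 𝒜 i, ∃ v ∈ 𝒱 j, x = tmul S a v}

/-- The grading of `A¹`, concentrated in degree `1`. -/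
def degOneGrading (𝒜 : ℕ → Submodule S A) (n : ℕ) : Submodule S (DegOne 𝒜) :=
  if n = 1 then ⊤ else ⊥

/-- The map `d₁ : A ⊗_S A¹ → A` induced by the multiplication of `A`. -/
noncomputable def d₁ (𝒜 : ℕ → Submodule S A) : TensorOver S A (DegOne 𝒜) →ₗ[A] A :=
  Submodule.liftQ _
    (TensorProduct.AlgebraTensorModule.lift
      { toFun := fun a => (LinearMap.mulLeft ℤ a).comp
          (DegOne.incl 𝒜).toAddMonoidHom.toIntLinearMap
        map_add' := fun a b => LinearMap.ext fun _ => add_mul _ _ _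
        map_smul' := fun a b => LinearMap.ext fun _ => mul_assoc _ _ _ })
    (by
      rw [Submodule.span_le]
      rintro _ ⟨a, s, v, rfl⟩
      simp)

theorem d₁_tmul (𝒜 : ℕ → Submodule S A) (a : A) (x : DegOne 𝒜) :
    d₁ 𝒜 (tmul S a x) = a * DegOne.incl 𝒜 x := by
  simp [d₁, tmul]

/-- A projective resolution
`⋯ → A ⊗ V₄ → A ⊗ V₃ → A ⊗ V₂ → A ⊗ A¹ → A → S → 0`
of the left `A`-module `S`, where `d₁` is induced by the multiplication and `A → S` is the
projection onto `A⁰`, by graded morphisms, where the `Vₙ` are graded projective left `S`-modules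
and `Vₙ⁰ = Vₙ¹ = 0` for `n ≥ 3`.  The entry `V k` is `V_{k+2}`.

Exactness of `A ⊗ A¹ → A → S → 0` holds for every connected strongly graded `S`-ring. -/
structure Resolution (𝒜 : ℕ → Submodule S A) where
  V : ℕ → Type w
  [addCommGroup : ∀ k, AddCommGroup (V k)]
  [module : ∀ k, Module S (V k)]
  grading : ∀ k, ℕ → Submodule S (V k)
  isInternal : ∀ k, DirectSum.IsInternal (grading k)
  projective : ∀ k, Module.Projective S (V k)
  grading_eq_bot : ∀ k ≥ 1, ∀ i ≤ 1, grading k i = ⊥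
  d₂ : TensorOver S A (V 0) →ₗ[A] TensorOver S A (DegOne 𝒜)
  d : ∀ k, TensorOver S A (V (k + 1)) →ₗ[A] TensorOver S A (V k)
  d₂_graded : ∀ n, ∀ x ∈ tensorDeg 𝒜 (grading 0) n, d₂ x ∈ tensorDeg 𝒜 (degOneGrading 𝒜) n
  d_graded : ∀ k n, ∀ x ∈ tensorDeg 𝒜 (grading (k + 1)) n, d k x ∈ tensorDeg 𝒜 (grading k) n
  exact₁ : Function.Exact d₂ (d₁ 𝒜)
  exact₂ : Function.Exact (d 0) d₂
  exact : ∀ k, Function.Exact (d (k + 1)) (d k)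

attribute [instance] Resolution.addCommGroup Resolution.module

open Classical in
/-- The complexity `c_V` of a graded `S`-module: `c_V = -1` if `V = 0`, and
`c_V = sup {n - 1 | Vⁿ ≠ 0}` otherwise. -/
noncomputable def complexity {V : Type w} [AddCommGroup V] [Module S V]
    (𝒱 : ℕ → Submodule S V) : EReal :=
  if Subsingleton V then -1 else sSup {c | ∃ n : ℕ, 𝒱 n ≠ ⊥ ∧ c = (n : EReal) - 1}

/-- The complexity of the module `V₃` of a resolution. -/
noncomputable def Resolution.c₃ {𝒜 : ℕ → Submodule S A} (res : Resolution.{u, v, w} 𝒜) : EReal :=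
  complexity (res.grading 1)

end Resolution

end SRing

/-! Write `T` for the tensor ring `T_A` and `I ⊆ T[z]` for the ideal generated by `α_z(R)`. A
regular `z` is `c`-regular for every `c`, so only the converse has content.

Suppose `z p ∈ I`. Modulo `z I`, the element `z p` is a sum of products `a α_z(r) b`, and comparing
constant terms in `z` shows that the leading parts `a r b` cancel, degree by degree. Hence `z` is
regular as soon as, in every degree `n`, each such combination with vanishing leading part lies in
`z I`; this is `IsDivisible n`, and the reduction is `isRegular_z`. Leading part and lift are
carried along together as a pair in `T × T[z]`.

Divisibility is proved by induction on the degree. If `z` has no homogeneous annihilator of degree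
`n`, then divisibility holds in degree `n + 1`, because such a combination is `z` times an element
of degree `n`. This covers all `n ≤ c`. For every other `n` one has `V₃ⁿ⁺¹ = 0`, and the resolution
takes over (`isDivisible_succ_of_grading_eq_bot`), as follows.

Divide the pairs by the products (ideal of relations) `A¹` and by `0 × z I`, and let `Mⁿ` be the
image of the left combinations `∑ a α_z(r)` of degree `n`. A relation times a relation is trivial
there, so `I_A` annihilates `Mⁿ` and `A` acts. Sending `t v` to `π_A(t) ⊗ v` on leading parts gives
a map `μ : Mⁿ → A ⊗ A¹`. Divisibility in degree `n` makes `μ` injective in degree `n`; conversely,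
divisibility in degree `n` and injectivity in degree `n + 1` give divisibility in degree `n + 1`. As
`V₂` is projective, `d₂` lifts along `μ` to a map `f` from `A ⊗ V₂`, and minimality of `R` makes `f`
surjective onto each `Mⁿ`. If `μ` kills `f(x)` in degree `n + 1`, then `x = d₃ u`. Since `V₃ⁿ⁺¹ =
0`, `u` is a sum of terms `a u'` with `a ∈ A¹` and `u'` of degree `n`, and injectivity in degree `n`
gives `f(d₃ u') = 0`, hence `f(x) = 0`. -/

namespace SRing

universe u v w w'

/-! ### Tensor products `B ⊗_S V`. -/

section TensorOver

variable {S : Type u} {B : Type v} {V : Type w} [Ring S] [Ring B] [Module S B]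
  [IsScalarTower S B B] [AddCommGroup V] [Module S V]

theorem tmul_add (a : B) (v v' : V) : tmul S a (v + v') = tmul S a v + tmul S a v' := by
  simp [tmul, TensorProduct.tmul_add]

theorem add_tmul (a a' : B) (v : V) : tmul S (a + a') v = tmul S a v + tmul S a' v := by
  simp [tmul, TensorProduct.add_tmul]

theorem zero_tmul (v : V) : tmul S (0 : B) v = 0 := by
  simp [tmul]

theorem tmul_zero (a : B) : tmul S a (0 : V) = 0 := by
  simp [tmul]

theorem smul_tmul (a b : B) (v : V) : a • tmul S b v = tmul S (a * b) v := by
  rw [tmul, ← Submodule.Quotient.mk_smul, TensorProduct.smul_tmul']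
  rfl

theorem mul_smul_one_tmul (a : B) (s : S) (v : V) : tmul S (a * s • 1) v = tmul S a (s • v) :=
  (Submodule.Quotient.eq _).mpr (Submodule.subset_span ⟨a, s, v, rfl⟩)

theorem smul_tmul_one (s : S) (v : V) : s • tmul S (1 : B) v = tmul S 1 (s • v) := by
  rw [← mul_smul_one_tmul, one_mul, ← smul_one_smul B s (tmul S (1 : B) v), smul_tmul, mul_one]

/-- `tmul` as a biadditive map. -/
def tmulHom (S : Type u) (B : Type v) (V : Type w) [Ring S] [Ring B] [Module S B]
    [IsScalarTower S B B] [AddCommGroup V] [Module S V] : B →+ V →+ TensorOver S B V where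
  toFun a := ⟨⟨tmul S a, tmul_zero a⟩, tmul_add a⟩
  map_zero' := AddMonoidHom.ext zero_tmul
  map_add' a a' := AddMonoidHom.ext (add_tmul a a')

@[simp]
theorem tmulHom_apply (a : B) (v : V) : tmulHom S B V a v = tmul S a v := rfl

theorem TensorOver.induction {p : TensorOver S B V → Prop} (h0 : p 0)
    (ht : ∀ a v, p (tmul S a v)) (ha : ∀ x y, p x → p y → p (x + y)) (x : TensorOver S B V) :
    p x := by
  obtain ⟨x, rfl⟩ := Submodule.Quotient.mk_surjective _ x
  induction x with
  | zero => exact h0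
  | tmul a v => exact ht a v
  | add x y hx hy => exact ha _ _ hx hy

section lift
variable {M : Type w'} [AddCommGroup M] (h : B →+ V →+ M)
  (hh : ∀ b (s : S) v, h (b * s • 1) v = h b (s • v))

/-- The additive map on `B ⊗_S V` given by an `S`-balanced biadditive map. -/
noncomputable def TensorOver.liftAdd : TensorOver S B V →+ M :=
  QuotientAddGroup.lift (Submodule.toAddSubgroup _)
    (TensorProduct.liftAddHom (R := ℤ) h (fun r m n => by rw [map_zsmul, map_zsmul, AddMonoidHom.smul_apply])) (by
      intro x hx
      -- The lifted map is only additive while the relations span a `B`-submodule, so the vanishing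
      -- is proved for all multiples `b • x` at once.
      suffices ∀ b : B, TensorProduct.liftAddHom (R := ℤ) h (fun r m n => by rw [map_zsmul, map_zsmul, AddMonoidHom.smul_apply]) (b • x) = 0 by
        simpa using this 1
      replace hx : x ∈ Submodule.span B _ := hx
      induction hx using Submodule.span_induction with
      | mem x hx =>
        obtain ⟨a, s, v, rfl⟩ := hx
        intro b
        rw [smul_sub, TensorProduct.smul_tmul', TensorProduct.smul_tmul', map_sub]
        simp only [TensorProduct.liftAddHom_tmul, smul_eq_mul]
        rw [← mul_assoc, hh, sub_self]
      | zero => simp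
      | add x y _ _ hx hy => intro b; rw [smul_add, map_add, hx, hy, add_zero]
      | smul r x _ hx => intro b; rw [smul_smul]; exact hx _)

@[simp]
theorem TensorOver.liftAdd_tmul (b : B) (v : V) :
    TensorOver.liftAdd h hh (tmul S b v) = h b v := by
  exact TensorProduct.liftAddHom_tmul (R := ℤ) h
    (fun r m n => by rw [map_zsmul, map_zsmul, AddMonoidHom.smul_apply]) b v

end lift

end TensorOver

theorem end_add_apply {M : Type*} [AddCommMonoid M] (f g : AddMonoid.End M) (x : M) :
    (f + g) x = f x + g x := rfl

/-! ### The map `t v ↦ φ(t) ⊗ v` on a tensor ring. -/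

section derivation

variable {S : Type u} {B : Type v} {V : Type w} [Ring S] [Ring B] [Module S B]
  [IsScalarTower S B B] [AddCommGroup V] [Module S V] [Module Sᵐᵒᵖ V]

open TensorRing

/-- The left ideal `T_S(V) V`. -/
noncomputable def augIdeal (S : Type u) (V : Type w) [Ring S] [AddCommGroup V] [Module S V]
    [Module Sᵐᵒᵖ V] : Submodule (TensorRing S V) (TensorRing S V) :=
  Submodule.span _ (Set.range (ι S V))

theorem mul_ι_mem_augIdeal (t : TensorRing S V) (v : V) : t * ι S V v ∈ augIdeal S V :=
  (augIdeal S V).smul_mem t (Submodule.subset_span ⟨v, rfl⟩)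

theorem augIdeal_induction {p : TensorRing S V → Prop} (h0 : p 0)
    (ht : ∀ t v, p (t * ι S V v)) (ha : ∀ x y, x ∈ augIdeal S V → y ∈ augIdeal S V →
      p x → p y → p (x + y)) {x : TensorRing S V} (hx : x ∈ augIdeal S V) : p x := by
  -- The predicate need not be stable under left multiplication; proving it for all `t * x` absorbs
  -- the coefficients of the span.
  suffices ∀ t : TensorRing S V, p (t * x) by simpa using this 1
  induction hx using Submodule.span_induction with
  | mem x hx => obtain ⟨v, rfl⟩ := hx; exact fun t => ht t v
  | zero => intro t; simpa using h0
  | add x y hx hy hx' hy' =>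
    intro t
    rw [mul_add]
    exact ha _ _ ((augIdeal S V).smul_mem t hx) ((augIdeal S V).smul_mem t hy) (hx' t) (hy' t)
  | smul r x _ hx => intro t; rw [smul_eq_mul, ← mul_assoc]; exact hx _

theorem deg_succ_le_augIdeal {n : ℕ} {t : TensorRing S V} (ht : t ∈ deg S V (n + 1)) :
    t ∈ augIdeal S V := by
  rw [deg] at ht
  induction ht using Submodule.span_induction with
  | mem x hx => obtain ⟨t, _, v, rfl⟩ := hx; exact mul_ι_mem_augIdeal t v
  | zero => exact zero_mem _
  | add x y _ _ hx hy => exact add_mem hx hy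
  | smul r x _ hx => exact (augIdeal S V).smul_mem (scalar S V r) hx

@[elab_as_elim]
theorem TensorRing.induction {p : TensorRing S V → Prop} (scalar : ∀ s, p (scalar S V s))
    (ι : ∀ v, p (ι S V v)) (add : ∀ x y, p x → p y → p (x + y))
    (mul : ∀ x y, p x → p y → p (x * y)) (t : TensorRing S V) : p t := by
  have key : ∀ n, ∀ t ∈ deg S V n, p t := by
    intro n
    induction n with
    | zero =>
      intro t ht
      obtain ⟨s, rfl⟩ := Submodule.mem_span_singleton.mp ht
      rw [TensorRing.smul_def, mul_one]
      exact scalar s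
    | succ n ih =>
      intro t ht
      rw [deg] at ht
      induction ht using Submodule.span_induction with
      | mem x hx => obtain ⟨t, ht, v, rfl⟩ := hx; exact mul _ _ (ih t ht) (ι v)
      | zero => simpa using scalar 0
      | add x y _ _ hx hy => exact add _ _ hx hy
      | smul r x _ hx => exact mul _ _ (scalar r) hx
  induction t using DirectSum.Decomposition.inductionOn (deg S V) with
  | zero => simpa using scalar 0
  | add x y hx hy => exact add _ _ hx hy
  | homogeneous t => exact key _ t t.2

variable [SMulCommClass S Sᵐᵒᵖ V]

/-- The right action of `S` on `B ⊗_S V`. -/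
noncomputable def tmulRight (B : Type v) (V : Type w) [Ring B] [Module S B]
    [IsScalarTower S B B] [AddCommGroup V] [Module S V] [Module Sᵐᵒᵖ V]
    [SMulCommClass S Sᵐᵒᵖ V] (s : S) : TensorOver S B V →+ TensorOver S B V :=
  TensorOver.liftAdd ((tmulHom S B V).compr₂ (.id _) |>.compl₂
      (DistribSMul.toAddMonoidHom V (MulOpposite.op s)))
    (fun b r v => by
      change tmul S _ (MulOpposite.op s • v) = tmul S _ (MulOpposite.op s • r • v)
      rw [mul_smul_one_tmul, smul_comm])

theorem tmulRight_tmul (s : S) (b : B) (v : V) :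
    tmulRight B V s (tmul S b v) = tmul S b (MulOpposite.op s • v) :=
  TensorOver.liftAdd_tmul _ _ _ _

/-- The right action of `S` on `T_S(V) × (B ⊗_S V)`. -/
noncomputable def extScalar (s : S) :
    AddMonoid.End (TensorRing S V × TensorOver S B V) :=
  AddMonoidHom.prodMap (AddMonoidHom.mulRight (scalar S V s)) (tmulRight B V s)

variable (φ : TensorRing S V →+* B)

/-- The right action of `V` on `T_S(V) × (B ⊗_S V)`, given by `(t, x) v = (t v, φ t ⊗ v)`. -/
noncomputable def extVec (v : V) :
    AddMonoid.End (TensorRing S V × TensorOver S B V) :=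
  (AddMonoidHom.prod (AddMonoidHom.mulRight (ι S V v))
    (((tmulHom S B V).flip v).comp φ.toAddMonoidHom)).comp (AddMonoidHom.fst _ _)

theorem extScalar_apply (s : S) (t : TensorRing S V) (x : TensorOver S B V) :
    extScalar s (t, x) = (t * scalar S V s, tmulRight B V s x) := rfl

omit [SMulCommClass S Sᵐᵒᵖ V] in
theorem extVec_apply (v : V) (t : TensorRing S V) (x : TensorOver S B V) :
    extVec φ v (t, x) = (t * ι S V v, tmul S (φ t) v) := rfl

theorem tmulRight_one : tmulRight B V (1 : S) = .id _ := by
  ext x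
  induction x using TensorOver.induction with
  | h0 => simp
  | ht a v => simp [tmulRight_tmul]
  | ha x y hx hy => simp [hx, hy]

theorem tmulRight_add (s t : S) : tmulRight B V (s + t) = tmulRight B V s + tmulRight B V t := by
  ext x
  induction x using TensorOver.induction with
  | h0 => simp
  | ht a v => simp [tmulRight_tmul, add_smul, tmul_add]
  | ha x y hx hy => simp only [map_add, hx, hy]

theorem tmulRight_mul (s t : S) :
    tmulRight B V (s * t) = (tmulRight B V t).comp (tmulRight B V s) := by
  ext x
  induction x using TensorOver.induction with
  | h0 => simp
  | ht a v => simp [tmulRight_tmul, mul_smul]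
  | ha x y hx hy => simp only [map_add, hx, hy]

/-- The right action of `T_S(V)` on `T_S(V) × (B ⊗_S V)`. -/
noncomputable def extAction (hφ : ∀ s, φ (scalar S V s) = s • 1) :
    TensorRing S V →+* (AddMonoid.End (TensorRing S V × TensorOver S B V))ᵐᵒᵖ :=
  TensorRing.lift
    { toFun := fun s => MulOpposite.op (extScalar s)
      map_one' := by
        refine MulOpposite.unop_injective (DFunLike.ext _ _ fun x => ?_)
        obtain ⟨t, x⟩ := x
        simp [extScalar_apply, tmulRight_one]
      map_mul' := fun s s' => by
        refine MulOpposite.unop_injective (DFunLike.ext _ _ fun x => ?_)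
        obtain ⟨t, x⟩ := x
        simp [extScalar_apply, tmulRight_mul, mul_assoc]
      map_zero' := by
        refine MulOpposite.unop_injective (DFunLike.ext _ _ fun x => ?_)
        obtain ⟨t, x⟩ := x
        have : tmulRight B V (0 : S) = 0 := by
          have := tmulRight_add (B := B) (V := V) (0 : S) 0
          rw [add_zero] at this
          exact left_eq_add.mp this
        simp [extScalar_apply, this]
      map_add' := fun s s' => by
        refine MulOpposite.unop_injective (DFunLike.ext _ _ fun x => ?_)
        obtain ⟨t, x⟩ := x
        simp [extScalar_apply, tmulRight_add, mul_add, end_add_apply] }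
    { toFun := fun v => MulOpposite.op (extVec φ v)
      map_zero' := by
        refine MulOpposite.unop_injective (DFunLike.ext _ _ fun x => ?_)
        obtain ⟨t, x⟩ := x
        simp [extVec_apply, tmul_zero]
      map_add' := fun s s' => by
        refine MulOpposite.unop_injective (DFunLike.ext _ _ fun x => ?_)
        obtain ⟨t, x⟩ := x
        simp [extVec_apply, tmul_add, mul_add, end_add_apply] }
    -- Compatibility with the left action of `S` is the balancing relation `φ(t) s ⊗ v = φ(t) ⊗ s
    -- v`.
    (fun s v => by
      refine MulOpposite.unop_injective (DFunLike.ext _ _ fun x => ?_)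
      obtain ⟨t, x⟩ := x
      simp [extVec_apply, extScalar_apply, hφ, mul_smul_one_tmul, TensorRing.smul_def, mul_assoc])
    (fun s v => by
      refine MulOpposite.unop_injective (DFunLike.ext _ _ fun x => ?_)
      obtain ⟨t, x⟩ := x
      simp [extVec_apply, extScalar_apply, tmulRight_tmul, ι_op_smul, mul_assoc])

variable (hφ : ∀ s, φ (scalar S V s) = s • 1)

theorem extAction_scalar (s : S) (x) :
    (extAction φ hφ (scalar S V s)).unop x = extScalar s x := by
  rw [extAction, TensorRing.lift_scalar]; rfl

theorem extAction_ι (v : V) (x) :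
    (extAction φ hφ (ι S V v)).unop x = extVec φ v x := by
  rw [extAction, TensorRing.lift_ι]; rfl

/-- The map `T_S(V) → B ⊗_S V` that sends `t v` to `φ t ⊗ v` and `S` to `0`. -/
noncomputable def cutAdd : TensorRing S V →+ TensorOver S B V where
  -- The universal property of `T_S(V)` yields ring morphisms only, and this map is not one. It is
  -- read off as the second coordinate of `(1, 0)` acted on by `t`, while the first coordinate
  -- remembers the word read so far.
  toFun t := ((extAction φ hφ t).unop (1, 0)).2
  map_zero' := by simp
  map_add' s t := by simp [end_add_apply]

theorem extAction_fst (t : TensorRing S V) (x) :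
    ((extAction φ hφ t).unop x).1 = x.1 * t := by
  induction t using TensorRing.induction generalizing x with
  | scalar s => rw [extAction_scalar]; rfl
  | ι v => rw [extAction_ι]; rfl
  | add s t hs ht => simp [mul_add, hs, ht, end_add_apply]
  | mul s t hs ht => simp [hs, ht, mul_assoc]

theorem cutAdd_mul_ι (t : TensorRing S V) (v : V) :
    cutAdd φ hφ (t * ι S V v) = tmul S (φ t) v := by
  change ((extAction φ hφ (t * ι S V v)).unop (1, 0)).2 = _
  rw [map_mul, MulOpposite.unop_mul, AddMonoid.End.coe_mul, Function.comp_apply, extAction_ι]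
  change tmul S (φ ((extAction φ hφ t).unop (1, 0)).1) v = _
  rw [extAction_fst, one_mul]

theorem cutAdd_scalar (s : S) : cutAdd φ hφ (scalar S V s) = 0 := by
  change ((extAction φ hφ (scalar S V s)).unop (1, 0)).2 = _
  rw [extAction_scalar, extScalar_apply, map_zero]

/-- Scalars are sent to `0`, so the rule is stated on `T_S(V) V`: at `x = 1` its right side would be
`0`, but its left side `cutAdd φ hφ t`. -/
theorem cutAdd_mul (t : TensorRing S V) {x : TensorRing S V} (hx : x ∈ augIdeal S V) :
    cutAdd φ hφ (t * x) = φ t • cutAdd φ hφ x := by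
  refine augIdeal_induction (p := fun x => cutAdd φ hφ (t * x) = φ t • cutAdd φ hφ x)
    (by simp) (fun t' v => ?_) (fun x y _ _ hx hy => ?_) hx
  · rw [← mul_assoc, cutAdd_mul_ι, cutAdd_mul_ι, smul_tmul, map_mul]
  · rw [mul_add, map_add, map_add, hx, hy, smul_add]

/-- The map `cutAdd` as a morphism of left `S`-modules. -/
noncomputable def cut : TensorRing S V →ₗ[S] TensorOver S B V where
  toFun := cutAdd φ hφ
  map_add' := map_add _
  map_smul' s t := by
    rw [RingHom.id_apply]
    induction t using DirectSum.Decomposition.inductionOn (deg S V) with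
    | zero => simp
    | add x y hx hy => rw [smul_add, map_add, map_add, hx, hy, smul_add]
    | @homogeneous n t =>
      obtain ⟨t, ht⟩ := t
      cases n with
      | zero =>
        obtain ⟨r, rfl⟩ := Submodule.mem_span_singleton.mp ht
        simp only [TensorRing.smul_def, mul_one, ← map_mul, cutAdd_scalar, smul_zero]
      | succ n =>
        rw [TensorRing.smul_def, cutAdd_mul _ _ _ (deg_succ_le_augIdeal ht), hφ, smul_one_smul]

theorem cut_mul_ι (t : TensorRing S V) (v : V) :
    cut φ hφ (t * ι S V v) = tmul S (φ t) v := cutAdd_mul_ι φ hφ t v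

theorem cut_mul (t : TensorRing S V) {x : TensorRing S V} (hx : x ∈ augIdeal S V) :
    cut φ hφ (t * x) = φ t • cut φ hφ x := cutAdd_mul φ hφ t hx

end derivation

/-! ### Coordinates of `T_S(V) V` along a dual basis of `V`. -/

section coordinates

variable {S : Type u} {B : Type v} {V : Type w} [Ring S] [Ring B] [Module S B]
  [IsScalarTower S B B] [AddCommGroup V] [Module S V]

/-- The map `B ⊗_S V → B^(V)` induced by a morphism `c : V → S^(V)`. -/
noncomputable def coord (B : Type v) [Ring B] [Module S B] [IsScalarTower S B B]
    (c : V →ₗ[S] V →₀ S) : TensorOver S B V →+ (V →₀ B) :=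
  TensorOver.liftAdd
    { toFun := fun b => (Finsupp.mapRange.addMonoidHom
        ((AddMonoidHom.mulLeft b).comp (RingHom.smulOneHom (R := S) (S := B)).toAddMonoidHom)).comp
          c.toAddMonoidHom
      map_zero' := by ext v i; simp
      map_add' := fun a b => by ext v i; simp [add_mul] }
    (fun b s v => by ext i; simp [mul_assoc, mul_smul])

theorem coord_tmul (c : V →ₗ[S] V →₀ S) (b : B) (v i : V) :
    coord B c (tmul S b v) i = b * c v i • 1 := by
  simp [coord]

open TensorRing

variable [Module Sᵐᵒᵖ V] [SMulCommClass S Sᵐᵒᵖ V]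

theorem map_coord_cut (c : V →ₗ[S] V →₀ S) (φ : TensorRing S V →+* B)
    (hφ : ∀ s, φ (scalar S V s) = s • 1) {t : TensorRing S V} (ht : t ∈ augIdeal S V) (i : V) :
    φ (coord (TensorRing S V) c (cut (.id _) (fun _ => (mul_one _).symm) t) i) =
      coord B c (cut φ hφ t) i := by
  refine augIdeal_induction (p := fun t => φ (coord (TensorRing S V) c
    (cut (.id _) (fun _ => (mul_one _).symm) t) i) = coord B c (cut φ hφ t) i)
    (by simp) (fun t v => ?_) (fun x y _ _ hx hy => by simp only [map_add, Finsupp.add_apply, hx, hy]) ht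
  simp [cut_mul_ι, coord_tmul, TensorRing.smul_def, hφ]

/-- The coordinates of an element of `T_S(V) V` along the generators of `V`. -/
noncomputable def rightCoord (c : V →ₗ[S] V →₀ S) : TensorRing S V →+ (V →₀ TensorRing S V) :=
  (coord (TensorRing S V) c).comp
    (cut (B := TensorRing S V) (.id _) (fun _ => (mul_one _).symm)).toAddMonoidHom

theorem rightCoord_mul_ι (c : V →ₗ[S] V →₀ S) (t : TensorRing S V) (v i : V) :
    rightCoord c (t * ι S V v) i = t * scalar S V (c v i) := by
  change coord (TensorRing S V) c (cut (.id _) (fun _ => (mul_one _).symm) (t * ι S V v)) i = _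
  rw [cut_mul_ι, coord_tmul, TensorRing.smul_def, mul_one]
  rfl

theorem rightCoord_smul (c : V →ₗ[S] V →₀ S) (s : S) {t : TensorRing S V}
    (ht : t ∈ augIdeal S V) (i : V) :
    rightCoord c (s • t) i = s • rightCoord c t i := by
  refine augIdeal_induction (p := fun t => rightCoord c (s • t) i = s • rightCoord c t i)
    (by simp) (fun t v => ?_) (fun x y _ _ hx hy => ?_) ht
  · rw [← smul_mul_assoc, rightCoord_mul_ι, rightCoord_mul_ι, smul_mul_assoc]
  · rw [smul_add, map_add, map_add, Finsupp.add_apply, Finsupp.add_apply, hx, hy, smul_add]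

/-- Taking coordinates commutes with `φ`. Together with `sum_rightCoord` this shows that the kernel
of `cut φ` on `T_S(V) V` lies in `(ker φ) V`; the projectivity of `V` enters through the dual basis
`c`. -/
theorem map_rightCoord (c : V →ₗ[S] V →₀ S) (φ : TensorRing S V →+* B)
    (hφ : ∀ s, φ (scalar S V s) = s • 1) {t : TensorRing S V} (ht : t ∈ augIdeal S V)
    (h : cut φ hφ t = 0) (i : V) : φ (rightCoord c t i) = 0 := by
  have := map_coord_cut c φ hφ ht i
  rw [h, map_zero] at this
  exact this

theorem rightCoord_mem (c : V →ₗ[S] V →₀ S) {n : ℕ} {t : TensorRing S V}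
    (ht : t ∈ deg S V (n + 1)) (i : V) : rightCoord c t i ∈ deg S V n := by
  rw [deg] at ht
  induction ht using Submodule.span_induction with
  | mem x hx =>
    obtain ⟨t, ht, v, rfl⟩ := hx
    rw [rightCoord_mul_ι]
    exact mul_scalar_mem ht _
  | zero => simp
  | add x y _ _ hx hy => rw [map_add]; exact add_mem hx hy
  | smul r x hx hx' =>
    rw [rightCoord_smul _ _ (deg_succ_le_augIdeal (n := n) hx)]
    exact Submodule.smul_mem _ _ hx'

variable {c : V →ₗ[S] V →₀ S} (hc : ∀ v, Finsupp.linearCombination S id (c v) = v)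
include hc

omit [SMulCommClass S Sᵐᵒᵖ V] in
theorem sum_scalar_mul_ι (v : V) :
    ((c v).sum fun i s => scalar S V s * ι S V i) = ι S V v := by
  conv_rhs => rw [← hc v, Finsupp.linearCombination_apply, map_finsuppSum]
  simp [TensorRing.smul_def]

/-- Here `c` is a section of the canonical map `S^(V) → V`, i.e. a dual basis indexed by the
elements of `V` themselves. -/
theorem sum_rightCoord {t : TensorRing S V} (ht : t ∈ augIdeal S V) :
    ((rightCoord c t).sum fun i x => x * ι S V i) = t := by
  refine augIdeal_induction (p := fun t => ((rightCoord c t).sum fun i x => x * ι S V i) = t)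
    (by simp) (fun t v => ?_) (fun x y _ _ hx hy => ?_) ht
  · have : rightCoord c (t * ι S V v) = (c v).mapRange (fun s => t * scalar S V s) (by simp) := by
      ext i
      rw [rightCoord_mul_ι, Finsupp.mapRange_apply]
    rw [this, Finsupp.sum_mapRange_index (by simp)]
    conv_rhs => rw [← sum_scalar_mul_ι hc v, Finsupp.mul_sum]
    simp only [mul_assoc]
  · rw [map_add, Finsupp.sum_add_index' (by simp) (by simp [add_mul]), hx, hy]

end coordinates

/-! ### The grading of `A ⊗_S V`. -/

section grading

variable {S : Type u} {A : Type v} {V : Type w} [Ring S] [Ring A] [Module S A]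
  [IsScalarTower S A A] [AddCommGroup V] [Module S V] {𝒜 : ℕ → Submodule S A}
  {𝒱 : ℕ → Submodule S V}

theorem tmul_mem_tensorDeg {i j n : ℕ} (h : i + j = n) {a : A} (ha : a ∈ 𝒜 i) {v : V}
    (hv : v ∈ 𝒱 j) : tmul S a v ∈ tensorDeg 𝒜 𝒱 n :=
  AddSubgroup.subset_closure ⟨i, j, h, a, ha, v, hv, rfl⟩

section
variable [GradedRing 𝒜]

theorem smul_mem_tensorDeg {i n : ℕ} {a : A} (ha : a ∈ 𝒜 i) {x : TensorOver S A V}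
    (hx : x ∈ tensorDeg 𝒜 𝒱 n) : a • x ∈ tensorDeg 𝒜 𝒱 (i + n) := by
  induction hx using AddSubgroup.closure_induction with
  | mem x hx =>
    obtain ⟨k, j, h, b, hb, v, hv, rfl⟩ := hx
    rw [smul_tmul]
    exact tmul_mem_tensorDeg (by omega) (SetLike.mul_mem_graded ha hb) hv
  | zero => simp
  | add x y _ _ hx hy => rw [smul_add]; exact add_mem hx hy
  | neg x _ hx => rw [smul_neg]; exact neg_mem hx

theorem iSup_tensorDeg (h : ⨆ n, 𝒱 n = ⊤) : ⨆ n, tensorDeg 𝒜 𝒱 n = ⊤ := by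
  rw [eq_top_iff]
  intro x _
  induction x using TensorOver.induction with
  | h0 => exact zero_mem _
  | ha x y hx hy => exact add_mem (hx trivial) (hy trivial)
  | ht a v =>
    induction a using DirectSum.Decomposition.inductionOn 𝒜 with
    | zero => rw [zero_tmul]; exact zero_mem _
    | add a b ha hb => rw [add_tmul]; exact add_mem (ha trivial) (hb trivial)
    | @homogeneous i a =>
      have hv : v ∈ ⨆ n, 𝒱 n := h ▸ Submodule.mem_top
      induction hv using Submodule.iSup_induction' with
      | mem j v hv =>
        exact AddSubgroup.mem_iSup_of_mem (i + j) (tmul_mem_tensorDeg rfl a.2 hv)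
      | zero => rw [tmul_zero]; exact zero_mem _
      | add v w _ _ hv hw => rw [tmul_add]; exact add_mem (hv trivial) (hw trivial)

omit [IsScalarTower S A A] in
theorem proj_mul_smul_one (n : ℕ) (a : A) (s : S) :
    GradedRing.proj 𝒜 n (a * s • 1) = GradedRing.proj 𝒜 n a * s • 1 := by
  have hs : s • (1 : A) ∈ 𝒜 0 := Submodule.smul_mem _ _ SetLike.GradedOne.one_mem
  simp only [GradedRing.proj_apply]
  simpa using DirectSum.coe_decompose_mul_add_of_right_mem 𝒜 (i := n) (a := a) hs

/-- The projection of `A ⊗_S V` onto its component of degree `n`, given the projections of `V`. -/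
noncomputable def tensorProj (𝒜 : ℕ → Submodule S A) [GradedRing 𝒜] (p : ℕ → V →ₗ[S] V) (n : ℕ) :
    TensorOver S A V →+ TensorOver S A V :=
  TensorOver.liftAdd
    (∑ ij ∈ Finset.HasAntidiagonal.antidiagonal n,
      ((tmulHom S A V).comp (GradedRing.proj 𝒜 ij.1)).compl₂ (p ij.2).toAddMonoidHom)
    (fun a s v => by
      simp only [AddMonoidHom.finsetSum_apply, AddMonoidHom.compl₂_apply, AddMonoidHom.comp_apply,
        LinearMap.toAddMonoidHom_coe, tmulHom_apply, map_smul, proj_mul_smul_one,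
        mul_smul_one_tmul])

theorem tensorProj_of_mem {p : ℕ → V →ₗ[S] V} (h : ∀ i j, ∀ v ∈ 𝒱 i, p j v = if i = j then v else 0)
    {m : ℕ} (n : ℕ) {x : TensorOver S A V} (hx : x ∈ tensorDeg 𝒜 𝒱 m) :
    tensorProj 𝒜 p n x = if m = n then x else 0 := by
  induction hx using AddSubgroup.closure_induction with
  | mem x hx =>
    obtain ⟨i, j, hij, a, ha, v, hv, rfl⟩ := hx
    simp only [tensorProj, TensorOver.liftAdd_tmul, AddMonoidHom.finsetSum_apply,
      AddMonoidHom.compl₂_apply, AddMonoidHom.comp_apply, LinearMap.toAddMonoidHom_coe,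
      tmulHom_apply, h j _ v hv, GradedRing.proj_apply, DirectSum.decompose_of_mem 𝒜 ha]
    have : ∀ kl : ℕ × ℕ, tmul S ((DirectSum.of (fun i => 𝒜 i) i ⟨a, ha⟩ kl.1 : 𝒜 kl.1) : A)
        (if j = kl.2 then v else 0) = if kl = (i, j) then tmul S a v else 0 := by
      rintro ⟨k, l⟩
      by_cases hk : i = k
      · subst hk
        by_cases hl : j = l
        · simp [hl]
        · simp [hl, Ne.symm hl, tmul_zero]
      · have hk' : k ≠ i := Ne.symm hk
        simp [DirectSum.of_eq_of_ne _ _ _ hk', hk', zero_tmul]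
    simp only [this, Finset.sum_ite_eq', Finset.HasAntidiagonal.mem_antidiagonal, hij]
  | zero => simp
  | add x y _ _ hx hy => rw [map_add, hx, hy]; split_ifs <;> simp
  | neg x _ hx => rw [map_neg, hx]; split_ifs <;> simp

end

/-- Makes exactness homogeneous: a preimage of a homogeneous element can be chosen of the same
degree. Only the target needs a projection `q`; on the source it suffices that the pieces span. -/
theorem exists_mem_of_mem_iSup {X Y : Type*} [AddCommGroup X] [AddCommGroup Y]
    {𝒳 : ℕ → AddSubgroup X} {𝒴 : ℕ → AddSubgroup Y} (d : X →+ Y)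
    (hd : ∀ n, ∀ x ∈ 𝒳 n, d x ∈ 𝒴 n) {q : Y →+ Y} {n : ℕ}
    (hq : ∀ m, ∀ y ∈ 𝒴 m, q y = if m = n then y else 0) {x : X} (hx : x ∈ ⨆ n, 𝒳 n) :
    ∃ x' ∈ 𝒳 n, d x' = q (d x) := by
  induction hx using AddSubgroup.iSup_induction' with
  | hp m x hx =>
    rw [hq m _ (hd m x hx)]
    split_ifs with h
    · exact ⟨x, h ▸ hx, rfl⟩
    · exact ⟨0, zero_mem _, map_zero d⟩
  | h1 => exact ⟨0, zero_mem _, by simp⟩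
  | hadd x y _ _ hx hy =>
    obtain ⟨x', hx', h⟩ := hx
    obtain ⟨y', hy', h'⟩ := hy
    exact ⟨x' + y', add_mem hx' hy', by simp only [map_add, h, h']⟩

variable (hstrong : IsStronglyGraded 𝒜)
include hstrong

/-- In degree `n + 1` a nonzero `a ⊗ v` must have `a` of positive degree, and strong grading splits
a factor from `A¹` off the left of `a`. This is how the vanishing of `V₃ⁿ⁺¹` is used. -/
theorem tensorDeg_succ_le {n : ℕ} (h : 𝒱 (n + 1) = ⊥) :
    tensorDeg 𝒜 𝒱 (n + 1) ≤
      AddSubgroup.closure {x | ∃ a ∈ 𝒜 1, ∃ u ∈ tensorDeg 𝒜 𝒱 n, x = a • u} := by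
  rw [tensorDeg, AddSubgroup.closure_le]
  rintro _ ⟨i, j, hij, a, ha, v, hv, rfl⟩
  rw [SetLike.mem_coe]
  cases i with
  | zero =>
    obtain rfl : j = n + 1 := by omega
    rw [h, Submodule.mem_bot] at hv
    rw [hv, tmul_zero]
    exact zero_mem _
  | succ i =>
    have ha' : a ∈ AddSubgroup.closure {x : A | ∃ a ∈ 𝒜 1, ∃ b ∈ 𝒜 i, x = a * b} := by
      rw [hstrong 1 i, add_comm]
      exact ha
    clear ha
    induction ha' using AddSubgroup.closure_induction with
    | mem a ha =>
      obtain ⟨a, ha, b, hb, rfl⟩ := ha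
      exact AddSubgroup.subset_closure
        ⟨a, ha, tmul S b v, tmul_mem_tensorDeg (by omega) hb hv, (smul_tmul _ _ _).symm⟩
    | zero => rw [zero_tmul]; exact zero_mem _
    | add x y _ _ hx hy => rw [add_tmul]; exact add_mem hx hy
    | neg x _ hx => rw [← tmulHom_apply, map_neg]; exact neg_mem hx

end grading

/-! ### Relations paired with their lifts, in `T_S(V) × T_S(V)[z]`. -/

section pairs

variable {S : Type u} {V : Type v} [Ring S] [AddCommGroup V] [Module S V] [Module Sᵐᵒᵖ V]

open TensorRing Polynomial

theorem proj_mul_scalar (n : ℕ) (t : TensorRing S V) (s : S) :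
    GradedRing.proj (deg S V) n (t * scalar S V s) =
      GradedRing.proj (deg S V) n t * scalar S V s := by
  have := proj_mul_smul_one (𝒜 := deg S V) n t s
  rwa [TensorRing.smul_def, mul_one] at this

theorem proj_of_mem {m : ℕ} (n : ℕ) {t : TensorRing S V} (ht : t ∈ deg S V m) :
    GradedRing.proj (deg S V) n t = if m = n then t else 0 := by
  rw [GradedRing.proj_apply]
  split_ifs with h
  · subst h
    exact DirectSum.decompose_of_mem_same _ ht
  · exact DirectSum.decompose_of_mem_ne _ ht h

/-- The homogeneous component of degree `n` of `T_S(V)[z]`. -/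
noncomputable def polyDeg (S : Type u) (V : Type v) [Ring S] [AddCommGroup V] [Module S V] [Module Sᵐᵒᵖ V]
    (n : ℕ) : AddSubgroup (TensorRing S V)[X] :=
  AddSubgroup.closure {p | ∃ i j : ℕ, i + j = n ∧ ∃ t ∈ deg S V i, p = C t * X ^ j}

theorem C_mul_X_pow_mem_polyDeg {i j n : ℕ} (h : i + j = n) {t : TensorRing S V}
    (ht : t ∈ deg S V i) : C t * X ^ j ∈ polyDeg S V n :=
  AddSubgroup.subset_closure ⟨i, j, h, t, ht, rfl⟩

theorem C_mul_mem_polyDeg {i n : ℕ} {t : TensorRing S V} (ht : t ∈ deg S V i)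
    {p : (TensorRing S V)[X]} (hp : p ∈ polyDeg S V n) : C t * p ∈ polyDeg S V (i + n) := by
  induction hp using AddSubgroup.closure_induction with
  | mem p hp =>
    obtain ⟨k, l, h, x, hx, rfl⟩ := hp
    rw [← mul_assoc, ← C_mul]
    exact C_mul_X_pow_mem_polyDeg (by omega) (SetLike.mul_mem_graded ht hx)
  | zero => simp
  | add x y _ _ hx hy => rw [mul_add]; exact add_mem hx hy
  | neg x _ hx => rw [mul_neg]; exact neg_mem hx

theorem mul_C_mem_polyDeg {i n : ℕ} {t : TensorRing S V} (ht : t ∈ deg S V i)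
    {p : (TensorRing S V)[X]} (hp : p ∈ polyDeg S V n) : p * C t ∈ polyDeg S V (n + i) := by
  induction hp using AddSubgroup.closure_induction with
  | mem p hp =>
    obtain ⟨k, l, h, x, hx, rfl⟩ := hp
    rw [mul_assoc, X_pow_mul_C, ← mul_assoc, ← C_mul]
    exact C_mul_X_pow_mem_polyDeg (by omega) (SetLike.mul_mem_graded hx ht)
  | zero => simp
  | add x y _ _ hx hy => rw [add_mul]; exact add_mem hx hy
  | neg x _ hx => rw [neg_mul]; exact neg_mem hx

theorem mul_X_pow_mem_polyDeg {n : ℕ} (l : ℕ)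
    {p : (TensorRing S V)[X]} (hp : p ∈ polyDeg S V n) : p * X ^ l ∈ polyDeg S V (n + l) := by
  induction hp using AddSubgroup.closure_induction with
  | mem p hp =>
    obtain ⟨k, l', h, x, hx, rfl⟩ := hp
    rw [mul_assoc, ← pow_add]
    exact C_mul_X_pow_mem_polyDeg (by omega) hx
  | zero => simp
  | add x y _ _ hx hy => rw [add_mul]; exact add_mem hx hy
  | neg x _ hx => rw [neg_mul]; exact neg_mem hx

theorem divX_mem_polyDeg {n : ℕ} {p : (TensorRing S V)[X]} (hp : p ∈ polyDeg S V (n + 1)) :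
    divX p ∈ polyDeg S V n := by
  induction hp using AddSubgroup.closure_induction with
  | mem p hp =>
    obtain ⟨k, l, h, x, hx, rfl⟩ := hp
    rw [divX_C_mul]
    cases l with
    | zero => simp
    | succ l =>
      rw [divX_X_pow, if_neg l.succ_ne_zero]
      exact C_mul_X_pow_mem_polyDeg (by omega) hx
  | zero => simp
  | add x y _ _ hx hy => rw [divX_add]; exact add_mem hx hy
  | neg x _ hx =>
    have : divX (-x) = -divX x := by ext; simp [coeff_divX]
    rw [this]
    exact neg_mem hx

/-- The projection of `T_S(V)[z]` onto its component of degree `n`. -/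
noncomputable def polyProj (S : Type u) (V : Type v) [Ring S] [AddCommGroup V] [Module S V]
    [Module Sᵐᵒᵖ V] (n : ℕ) : (TensorRing S V)[X] →+ (TensorRing S V)[X] :=
  ∑ i ∈ Finset.range (n + 1), (monomial i).toAddMonoidHom.comp
    ((GradedRing.proj (deg S V) (n - i)).comp (lcoeff (TensorRing S V) i).toAddMonoidHom)

theorem polyProj_of_mem {m : ℕ} (n : ℕ) {p : (TensorRing S V)[X]} (hp : p ∈ polyDeg S V m) :
    polyProj S V n p = if m = n then p else 0 := by
  induction hp using AddSubgroup.closure_induction with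
  | mem p hp =>
    obtain ⟨i, j, h, t, ht, rfl⟩ := hp
    have : ∀ k ∈ Finset.range (n + 1), monomial k (GradedRing.proj (deg S V) (n - k)
        ((C t * X ^ j).coeff k)) = if k = j then (if m = n then C t * X ^ j else 0) else 0 := by
      intro k hk
      rw [coeff_C_mul_X_pow]
      split_ifs with h1 h2
      · rw [proj_of_mem _ ht, if_pos (by omega), h1, C_mul_X_pow_eq_monomial]
      -- The bound `k ≤ n` matters: otherwise the truncated `n - k` could equal `i` although `i + k
      -- ≠ n`.
      · rw [proj_of_mem _ ht, if_neg (by have := Finset.mem_range.mp hk; omega), monomial_zero_right]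
      · rw [map_zero, monomial_zero_right]
    simp only [polyProj, AddMonoidHom.finsetSum_apply, AddMonoidHom.comp_apply,
      LinearMap.toAddMonoidHom_coe, lcoeff_apply]
    rw [Finset.sum_congr rfl this, Finset.sum_ite_eq']
    split_ifs with h1 h2 <;> first | rfl | (rw [Finset.mem_range] at h1; omega)
  | zero => simp
  | add x y _ _ hx hy => rw [map_add, hx, hy]; split_ifs <;> simp
  | neg x _ hx => rw [map_neg, hx]; split_ifs <;> simp

theorem polyProj_succ_X_mul (n : ℕ) (p : (TensorRing S V)[X]) :
    polyProj S V (n + 1) (X * p) = X * polyProj S V n p := by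
  simp only [polyProj, AddMonoidHom.finsetSum_apply, AddMonoidHom.comp_apply,
      LinearMap.toAddMonoidHom_coe, lcoeff_apply]
  rw [Finset.sum_range_succ']
  simp [coeff_X_mul, Finset.mul_sum, X_mul_monomial]

variable {R : GradedSubbimodule S V} (α : FilteredMap R)

/-- The component of degree `n` of `T_S(V)`, as a morphism. -/
noncomputable def tensorComponent (S : Type u) (V : Type v) [Ring S] [AddCommGroup V] [Module S V]
    [Module Sᵐᵒᵖ V] (n : ℕ) : TensorRing S V →ₗ[S] TensorRing S V where
  toFun := GradedRing.proj (deg S V) n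
  map_add' := map_add _
  map_smul' s t := by
    simp only [GradedRing.proj_apply, DirectSum.decompose_smul]
    rfl

/-- The map `r ↦ ∑ᵢ αᵢ(r) zⁱ` on elements of degree `n`. -/
noncomputable def FilteredMap.homog (n : ℕ) : R.toSubmodule →ₗ[S] (TensorRing S V)[X] :=
  ∑ i ∈ Finset.range (n + 1), (monomial i).restrictScalars S ∘ₗ
    tensorComponent S V (n - i) ∘ₗ α.toLinearMap

theorem FilteredMap.homog_apply (n : ℕ) (r : R.toSubmodule) : α.homog n r =
    ∑ i ∈ Finset.range (n + 1),
      C (DirectSum.decompose (deg S V) (α.toLinearMap r) (n - i) : TensorRing S V) * X ^ i := by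
  simp [homog, C_mul_X_pow_eq_monomial, tensorComponent]

theorem FilteredMap.alphaZ_eq_sum [∀ (i : ℕ) (x : deg S V i), Decidable (x ≠ 0)]
    (r : R.toSubmodule) : α.alphaZ r =
      ∑ n ∈ (DirectSum.decompose (deg S V) (r : TensorRing S V)).support,
        α.homog n (R.component n r) := by
  rw [alphaZ]
  simp only [homog_apply]
  congr!

theorem component_of_mem {n : ℕ} {r : R.toSubmodule} (hr : (r : TensorRing S V) ∈ deg S V n) :
    R.component n r = r :=
  Subtype.ext (DirectSum.decompose_of_mem_same _ hr)

theorem component_mem (n : ℕ) (r : R.toSubmodule) :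
    (R.component n r : TensorRing S V) ∈ deg S V n :=
  (DirectSum.decompose (deg S V) (r : TensorRing S V) n).2

theorem FilteredMap.alphaZ_of_mem {n : ℕ} {r : R.toSubmodule}
    (hr : (r : TensorRing S V) ∈ deg S V n) : α.alphaZ r = α.homog n r := by
  classical
  rw [alphaZ_eq_sum, DirectSum.decompose_of_mem _ hr]
  by_cases h : r = 0
  · subst h
    have : (⟨((0 : R.toSubmodule) : TensorRing S V), hr⟩ : deg S V n) = 0 := rfl
    rw [this, map_zero, map_zero]
    simp
  · rw [DirectSum.support_of _ _ (fun h' : (⟨r, hr⟩ : deg S V n) = 0 =>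
        h (Subtype.ext (congrArg (fun x : deg S V n => (x : TensorRing S V)) h'))),
      Finset.sum_singleton, component_of_mem hr]

theorem FilteredMap.homog_mem_extIdeal {n : ℕ} {r : R.toSubmodule}
    (hr : (r : TensorRing S V) ∈ deg S V n) : α.homog n r ∈ α.extIdeal :=
  TwoSidedIdeal.subset_span ⟨r, α.alphaZ_of_mem hr⟩

theorem FilteredMap.homog_mem_polyDeg (n : ℕ) (r : R.toSubmodule) :
    α.homog n r ∈ polyDeg S V n := by
  rw [homog_apply]
  refine sum_mem fun i hi => C_mul_X_pow_mem_polyDeg ?_ (SetLike.coe_mem _)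
  have := Finset.mem_range.mp hi
  omega

theorem FilteredMap.homog_coeff_zero {n : ℕ} {r : R.toSubmodule}
    (hr : (r : TensorRing S V) ∈ deg S V n) : (α.homog n r).coeff 0 = r := by
  rw [homog_apply, finsetSum_coeff, Finset.sum_eq_single 0]
  · simpa using α.leading' n r hr
  · intro i _ hi
    rw [coeff_C_mul_X_pow, if_neg (Ne.symm hi)]
  · simp

/-- The element `r s` of `R`. -/
noncomputable def GradedSubbimodule.mulScalar (r : R.toSubmodule) (s : S) : R.toSubmodule :=
  ⟨r * scalar S V s, R.mul_scalar_mem' r r.2 s⟩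

theorem FilteredMap.homog_mulScalar (n : ℕ) (r : R.toSubmodule) (s : S) :
    α.homog n (R.mulScalar r s) = α.homog n r * C (scalar S V s) := by
  have h : α.toLinearMap (R.mulScalar r s) = α.toLinearMap r * scalar S V s := α.map_right' r s
  rw [homog_apply, homog_apply, h, Finset.sum_mul]
  refine Finset.sum_congr rfl fun i _ => ?_
  have := proj_mul_scalar (n - i) (α.toLinearMap r) s
  simp only [GradedRing.proj_apply] at this
  rw [this, C_mul, mul_assoc, mul_assoc, X_pow_mul]

/-- The map `r ↦ (r, ∑ᵢ αᵢ(r) zⁱ)` on elements of degree `n`. -/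
noncomputable def FilteredMap.pair (n : ℕ) :
    R.toSubmodule →ₗ[S] TensorRing S V × (TensorRing S V)[X] :=
  R.toSubmodule.subtype.prod (α.homog n)

theorem FilteredMap.pair_apply (n : ℕ) (r : R.toSubmodule) :
    α.pair n r = ((r : TensorRing S V), α.homog n r) := rfl

/-- Right multiplication by `b` on `T_S(V) × T_S(V)[z]`. -/
noncomputable def pairMul (b : TensorRing S V) :
    TensorRing S V × (TensorRing S V)[X] →ₗ[TensorRing S V]
      TensorRing S V × (TensorRing S V)[X] where
  toFun x := (x.1 * b, x.2 * C b)
  map_add' x y := by simp [add_mul]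
  map_smul' t x := by simp [mul_assoc, smul_eq_C_mul]

theorem pairMul_apply (b : TensorRing S V) (x) :
    pairMul b x = (x.1 * b, x.2 * C b) := rfl

theorem pairMul_mul (b c : TensorRing S V) (x) :
    pairMul (b * c) x = pairMul c (pairMul b x) := by
  simp [pairMul_apply, mul_assoc]

theorem pairMul_add (b c : TensorRing S V) (x) :
    pairMul (b + c) x = pairMul b x + pairMul c x := by
  simp [pairMul_apply, mul_add]

theorem pairMul_zero (x : TensorRing S V × (TensorRing S V)[X]) : pairMul 0 x = 0 := by
  simp [pairMul_apply]

theorem pairMul_one (x : TensorRing S V × (TensorRing S V)[X]) : pairMul 1 x = x := by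
  simp [pairMul_apply]

theorem pairMul_smul (s : S) (b : TensorRing S V) (x) :
    pairMul (s • b) x = pairMul b (pairMul (scalar S V s) x) := by
  rw [TensorRing.smul_def, pairMul_mul]

theorem FilteredMap.pairMul_scalar_pair (n : ℕ) (s : S) (r : R.toSubmodule) :
    pairMul (scalar S V s) (α.pair n r) = α.pair n (R.mulScalar r s) := by
  rw [pair_apply, pair_apply, homog_mulScalar]
  rfl

/-- The part of degree `n` of the left ideal generated by the relations. -/
noncomputable def FilteredMap.leftDeg (n : ℕ) :
    Submodule S (TensorRing S V × (TensorRing S V)[X]) :=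
  Submodule.span S {x | ∃ i j : ℕ, i + j = n ∧ ∃ a ∈ deg S V i, ∃ r : R.toSubmodule,
    (r : TensorRing S V) ∈ deg S V j ∧ x = a • α.pair j r}

/-- The part of degree `n` of the two-sided ideal generated by the relations. -/
noncomputable def FilteredMap.idealDeg (n : ℕ) :
    Submodule S (TensorRing S V × (TensorRing S V)[X]) :=
  Submodule.span S {x | ∃ i k : ℕ, i + k = n ∧ ∃ y ∈ α.leftDeg i, ∃ b ∈ deg S V k,
    x = pairMul b y}

/-- The part of degree `n` of the product of the ideal of relations and `V`. -/
noncomputable def FilteredMap.rightDeg (n : ℕ) :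
    Submodule S (TensorRing S V × (TensorRing S V)[X]) :=
  Submodule.span S {x | ∃ m : ℕ, m + 1 = n ∧ ∃ y ∈ α.idealDeg m, ∃ v : V,
    x = pairMul (ι S V v) y}

variable {α}

theorem smul_mem_leftDeg {i n : ℕ} {t : TensorRing S V} (ht : t ∈ deg S V i) {x}
    (hx : x ∈ α.leftDeg n) : t • x ∈ α.leftDeg (i + n) := by
  -- Left multiplication by `t` is not `S`-linear; with `t` arbitrary, `t • s • x = (t s) • x` moves
  -- the scalar into `t`, which keeps its degree.
  suffices h : ∀ t ∈ deg S V i, t • x ∈ α.leftDeg (i + n) from h t ht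
  clear ht t
  induction hx using Submodule.span_induction with
  | mem x hx =>
    obtain ⟨k, j, h, a, ha, r, hr, rfl⟩ := hx
    intro t ht
    rw [smul_smul]
    exact Submodule.subset_span ⟨i + k, j, by omega, _, SetLike.mul_mem_graded ht ha, r, hr, rfl⟩
  | zero => simp
  | add x y _ _ hx hy => intro t ht; rw [smul_add]; exact add_mem (hx t ht) (hy t ht)
  | smul s x _ hx =>
    intro t ht
    have : t • s • x = (t * scalar S V s) • x := by
      rw [mul_smul, ← smul_one_smul (TensorRing S V) s x, TensorRing.smul_def, mul_one]
    rw [this]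
    exact hx _ (mul_scalar_mem ht s)

theorem pairMul_scalar_mem_leftDeg {n : ℕ} (s : S) {x} (hx : x ∈ α.leftDeg n) :
    pairMul (scalar S V s) x ∈ α.leftDeg n := by
  induction hx using Submodule.span_induction with
  | mem x hx =>
    obtain ⟨k, j, h, a, ha, r, hr, rfl⟩ := hx
    rw [map_smul, FilteredMap.pairMul_scalar_pair]
    exact Submodule.subset_span ⟨k, j, h, a, ha, _, mul_scalar_mem hr s, rfl⟩
  | zero => simp
  | add x y _ _ hx hy => rw [map_add]; exact add_mem hx hy
  | smul s x _ hx => rw [LinearMap.map_smul_of_tower]; exact Submodule.smul_mem _ _ hx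

theorem leftDeg_le_idealDeg (n : ℕ) : α.leftDeg n ≤ α.idealDeg n := fun x hx =>
  Submodule.subset_span ⟨n, 0, rfl, x, hx, 1, SetLike.GradedOne.one_mem, (pairMul_one x).symm⟩

theorem smul_mem_idealDeg {i n : ℕ} {t : TensorRing S V} (ht : t ∈ deg S V i) {x}
    (hx : x ∈ α.idealDeg n) : t • x ∈ α.idealDeg (i + n) := by
  suffices h : ∀ t ∈ deg S V i, t • x ∈ α.idealDeg (i + n) from h t ht
  clear ht t
  induction hx using Submodule.span_induction with
  | mem x hx =>
    obtain ⟨k, j, h, a, ha, b, hb, rfl⟩ := hx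
    intro t ht
    rw [← map_smul]
    exact Submodule.subset_span ⟨i + k, j, by omega, _, smul_mem_leftDeg ht ha, b, hb, rfl⟩
  | zero => simp
  | add x y _ _ hx hy => intro t ht; rw [smul_add]; exact add_mem (hx t ht) (hy t ht)
  | smul s x _ hx =>
    intro t ht
    have : t • s • x = (t * scalar S V s) • x := by
      rw [mul_smul, ← smul_one_smul (TensorRing S V) s x, TensorRing.smul_def, mul_one]
    rw [this]
    exact hx _ (mul_scalar_mem ht s)

theorem pairMul_mem_idealDeg {i n : ℕ} {t : TensorRing S V} (ht : t ∈ deg S V i) {x}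
    (hx : x ∈ α.idealDeg n) : pairMul t x ∈ α.idealDeg (n + i) := by
  induction hx using Submodule.span_induction with
  | mem x hx =>
    obtain ⟨k, j, h, a, ha, b, hb, rfl⟩ := hx
    rw [← pairMul_mul]
    exact Submodule.subset_span ⟨k, j + i, by omega, _, ha, _, SetLike.mul_mem_graded hb ht, rfl⟩
  | zero => simp
  | add x y _ _ hx hy => rw [map_add]; exact add_mem hx hy
  | smul s x _ hx => rw [LinearMap.map_smul_of_tower]; exact Submodule.smul_mem _ _ hx

theorem pairMul_ι_mem_rightDeg {n : ℕ} (v : V) {x} (hx : x ∈ α.idealDeg n) :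
    pairMul (ι S V v) x ∈ α.rightDeg (n + 1) :=
  Submodule.subset_span ⟨n, rfl, x, hx, v, rfl⟩

theorem smul_mem_rightDeg {i n : ℕ} {t : TensorRing S V} (ht : t ∈ deg S V i) {x}
    (hx : x ∈ α.rightDeg n) : t • x ∈ α.rightDeg (i + n) := by
  suffices h : ∀ t ∈ deg S V i, t • x ∈ α.rightDeg (i + n) from h t ht
  clear ht t
  induction hx using Submodule.span_induction with
  | mem x hx =>
    obtain ⟨m, rfl, y, hy, v, rfl⟩ := hx
    intro t ht
    rw [← map_smul]
    exact pairMul_ι_mem_rightDeg v (smul_mem_idealDeg ht hy)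
  | zero => simp
  | add x y _ _ hx hy => intro t ht; rw [smul_add]; exact add_mem (hx t ht) (hy t ht)
  | smul s x _ hx =>
    intro t ht
    have : t • s • x = (t * scalar S V s) • x := by
      rw [mul_smul, ← smul_one_smul (TensorRing S V) s x, TensorRing.smul_def, mul_one]
    rw [this]
    exact hx _ (mul_scalar_mem ht s)

theorem rightDeg_le_idealDeg (n : ℕ) : α.rightDeg n ≤ α.idealDeg n := by
  rw [FilteredMap.rightDeg, Submodule.span_le]
  rintro _ ⟨m, rfl, y, hy, v, rfl⟩
  exact pairMul_mem_idealDeg (ι_mem v) hy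

theorem pairMul_mem_rightDeg {n k : ℕ} {b : TensorRing S V} (hb : b ∈ deg S V (k + 1)) {x}
    (hx : x ∈ α.idealDeg n) : pairMul b x ∈ α.rightDeg (n + (k + 1)) := by
  suffices h : ∀ x ∈ α.idealDeg n, pairMul b x ∈ α.rightDeg (n + (k + 1)) from h x hx
  clear hx x
  rw [deg] at hb
  induction hb using Submodule.span_induction with
  | mem x hx =>
    obtain ⟨t, ht, v, rfl⟩ := hx
    intro x hx
    rw [pairMul_mul]
    exact pairMul_ι_mem_rightDeg v (pairMul_mem_idealDeg ht hx)
  | zero => intro x _; rw [pairMul_zero]; exact zero_mem _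
  | add x y _ _ hx hy => intro z hz; rw [pairMul_add]; exact add_mem (hx z hz) (hy z hz)
  | smul s x _ hx =>
    intro z hz
    rw [pairMul_smul]
    exact hx _ (by simpa using pairMul_mem_idealDeg (scalar_mem s) hz)

/-- A right factor `b` of degree `0` is a scalar and is absorbed by `R`, a right `S`-module; a `b`
of positive degree ends in an element of `V`. -/
theorem idealDeg_le (n : ℕ) : α.idealDeg n ≤ α.leftDeg n ⊔ α.rightDeg n := by
  rw [FilteredMap.idealDeg, Submodule.span_le]
  rintro _ ⟨i, k, rfl, y, hy, b, hb, rfl⟩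
  cases k with
  | zero =>
    obtain ⟨s, rfl⟩ := Submodule.mem_span_singleton.mp hb
    rw [TensorRing.smul_def, mul_one]
    exact Submodule.mem_sup_left (pairMul_scalar_mem_leftDeg s hy)
  | succ k =>
    exact Submodule.mem_sup_right (pairMul_mem_rightDeg hb (leftDeg_le_idealDeg i hy))

/-- An induction principle for `idealDeg`. -/
theorem idealDeg_induction {n : ℕ} {p : TensorRing S V × (TensorRing S V)[X] → Prop} (h0 : p 0)
    (ha : ∀ x y, p x → p y → p (x + y))
    (h : ∀ i j k : ℕ, i + j + k = n → ∀ a ∈ deg S V i, ∀ r : R.toSubmodule,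
      (r : TensorRing S V) ∈ deg S V j → ∀ b ∈ deg S V k, p (pairMul b (a • α.pair j r)))
    {x} (hx : x ∈ α.idealDeg n) : p x := by
  suffices ∀ s : S, p (s • x) by simpa using this 1
  induction hx using Submodule.span_induction with
  | mem x hx =>
    obtain ⟨i, k, hik, y, hy, b, hb, rfl⟩ := hx
    induction hy using Submodule.span_induction with
    | mem y hy =>
      obtain ⟨i', j, hij, a, ha, r, hr, rfl⟩ := hy
      intro s
      rw [← LinearMap.map_smul_of_tower, ← smul_assoc]
      exact h i' j k (by omega) _ (Submodule.smul_mem _ s ha) r hr b hb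
    | zero => intro s; simpa using h0
    | add x y _ _ hx hy => intro s; rw [map_add, smul_add]; exact ha _ _ (hx s) (hy s)
    | smul s x _ hx =>
      intro t
      rw [LinearMap.map_smul_of_tower, smul_smul]
      exact hx _
  | zero => intro s; simpa using h0
  | add x y _ _ hx hy => intro s; rw [smul_add]; exact ha _ _ (hx s) (hy s)
  | smul s x _ hx => intro t; rw [smul_smul]; exact hx _

theorem fst_mem_of_mem_idealDeg {n : ℕ} {x} (hx : x ∈ α.idealDeg n) : x.1 ∈ deg S V n := by
  refine idealDeg_induction (p := fun x => x.1 ∈ deg S V n) (zero_mem _)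
    (fun x y hx hy => add_mem hx hy) ?_ hx
  rintro i j k rfl a ha r hr b hb
  exact SetLike.mul_mem_graded (SetLike.mul_mem_graded ha hr) hb

theorem snd_mem_of_mem_idealDeg {n : ℕ} {x} (hx : x ∈ α.idealDeg n) : x.2 ∈ polyDeg S V n := by
  refine idealDeg_induction (p := fun x => x.2 ∈ polyDeg S V n) (zero_mem _)
    (fun x y hx hy => add_mem hx hy) ?_ hx
  rintro i j k rfl a ha r hr b hb
  refine mul_C_mem_polyDeg hb ?_
  rw [Prod.smul_snd, smul_eq_C_mul]
  exact C_mul_mem_polyDeg ha (α.homog_mem_polyDeg j r)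

theorem snd_mem_extIdeal {n : ℕ} {x} (hx : x ∈ α.idealDeg n) : x.2 ∈ α.extIdeal := by
  refine idealDeg_induction (p := fun x => x.2 ∈ α.extIdeal) (zero_mem _)
    (fun x y hx hy => add_mem hx hy) ?_ hx
  rintro i j k rfl a ha r hr b hb
  refine TwoSidedIdeal.mul_mem_right _ _ _ ?_
  rw [Prod.smul_snd, smul_eq_C_mul]
  exact TwoSidedIdeal.mul_mem_left _ _ _ (α.homog_mem_extIdeal hr)

/-- Thus a pair `(0, q)` has `q` divisible by `z` in `T_S(V)[z]`; the question is whether the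
quotient lies in the ideal of relations. -/
theorem snd_coeff_zero {n : ℕ} {x} (hx : x ∈ α.idealDeg n) : x.2.coeff 0 = x.1 := by
  refine idealDeg_induction (p := fun x => x.2.coeff 0 = x.1) (by simp)
    (fun x y hx hy => by simp [hx, hy]) ?_ hx
  rintro i j k rfl a ha r hr b hb
  simp [pairMul_apply, FilteredMap.pair_apply, FilteredMap.homog_coeff_zero _ hr]

end pairs

/-! ### Divisibility of relations by `z` and regularity of `z`. -/

section divisibility

variable {S : Type u} {V : Type v} [Ring S] [AddCommGroup V] [Module S V] [Module Sᵐᵒᵖ V]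

open TensorRing Polynomial

variable {R : GradedSubbimodule S V} (α : FilteredMap R)

/-- The homogeneous component of degree `n` of the ideal of relations of `D`. -/
noncomputable def FilteredMap.extDeg (n : ℕ) : AddSubgroup (TensorRing S V)[X] :=
  AddSubgroup.closure {p | ∃ m l : ℕ, m + l = n ∧ ∃ x ∈ α.idealDeg m, p = x.2 * X ^ l}

variable {α}

theorem mul_mem_extDeg {i n : ℕ} {t : TensorRing S V} (ht : t ∈ deg S V i) (k : ℕ)
    {p : (TensorRing S V)[X]} (hp : p ∈ α.extDeg n) :
    C t * X ^ k * p ∈ α.extDeg (i + k + n) ∧ p * (C t * X ^ k) ∈ α.extDeg (i + k + n) := by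
  induction hp using AddSubgroup.closure_induction with
  | mem p hp =>
    obtain ⟨m, l, h, x, hx, rfl⟩ := hp
    refine ⟨AddSubgroup.subset_closure ⟨i + m, k + l, by omega, t • x,
      smul_mem_idealDeg ht hx, ?_⟩, AddSubgroup.subset_closure ⟨m + i, l + k, by omega,
      pairMul t x, pairMul_mem_idealDeg ht hx, ?_⟩⟩
    · rw [Prod.smul_snd, smul_eq_C_mul, pow_add, mul_assoc, mul_assoc, ← mul_assoc (X ^ k),
        X_pow_mul, mul_assoc]
    · rw [pairMul_apply, pow_add, mul_assoc, mul_assoc, ← mul_assoc (X ^ l), X_pow_mul, mul_assoc]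
  | zero => simp
  | add x y _ _ hx hy =>
    rw [mul_add, add_mul]
    exact ⟨add_mem hx.1 hy.1, add_mem hx.2 hy.2⟩
  | neg x _ hx =>
    rw [mul_neg, neg_mul]
    exact ⟨neg_mem hx.1, neg_mem hx.2⟩

theorem mul_mem_iSup_extDeg (p : (TensorRing S V)[X]) {q : (TensorRing S V)[X]}
    (hq : q ∈ ⨆ n, α.extDeg n) : p * q ∈ ⨆ n, α.extDeg n ∧ q * p ∈ ⨆ n, α.extDeg n := by
  induction p using Polynomial.induction_on' with
  | add p p' hp hp' =>
    rw [mul_add, add_mul]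
    exact ⟨add_mem hp.1 hp'.1, add_mem hp.2 hp'.2⟩
  | monomial k t =>
    rw [← C_mul_X_pow_eq_monomial]
    induction t using DirectSum.Decomposition.inductionOn (deg S V) with
    | zero => simp
    | add t t' ht ht' =>
      rw [C_add, add_mul, add_mul, mul_add]
      exact ⟨add_mem ht.1 ht'.1, add_mem ht.2 ht'.2⟩
    | homogeneous t =>
      induction hq using AddSubgroup.iSup_induction' with
      | hp n q hq =>
        exact ⟨AddSubgroup.mem_iSup_of_mem _ (mul_mem_extDeg t.2 k hq).1,
          AddSubgroup.mem_iSup_of_mem _ (mul_mem_extDeg t.2 k hq).2⟩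
      | h1 => simp
      | hadd q q' _ _ hq hq' =>
        rw [mul_add, add_mul]
        exact ⟨add_mem hq.1 hq'.1, add_mem hq.2 hq'.2⟩

theorem homog_mem_extDeg {n : ℕ} {r : R.toSubmodule} (hr : (r : TensorRing S V) ∈ deg S V n) :
    α.homog n r ∈ α.extDeg n := by
  refine AddSubgroup.subset_closure ⟨n, 0, rfl, α.pair n r, leftDeg_le_idealDeg n
    (Submodule.subset_span ⟨0, n, zero_add n, 1, SetLike.GradedOne.one_mem, r, hr,
      (one_smul _ _).symm⟩), ?_⟩
  simp [FilteredMap.pair_apply]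

/-- The sum of the pieces `extDeg n` is a two-sided ideal containing the generators, so the ideal of
relations is spanned by its homogeneous parts. -/
theorem mem_iSup_extDeg {p : (TensorRing S V)[X]} (hp : p ∈ α.extIdeal) :
    p ∈ ⨆ n, α.extDeg n := by
  have h : α.extIdeal ≤ TwoSidedIdeal.mk' ((⨆ n, α.extDeg n : AddSubgroup _) : Set _)
      (zero_mem _) add_mem neg_mem (fun h => (mul_mem_iSup_extDeg _ h).1)
      (fun h => (mul_mem_iSup_extDeg _ h).2) := by
    classical
    refine TwoSidedIdeal.span_le.mpr ?_
    rintro _ ⟨r, rfl⟩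
    rw [SetLike.mem_coe, TwoSidedIdeal.mem_mk', SetLike.mem_coe, FilteredMap.alphaZ_eq_sum]
    exact sum_mem fun n _ => AddSubgroup.mem_iSup_of_mem n (homog_mem_extDeg (component_mem n r))
  simpa using h hp

/-- For the last claim, split the generators `x.2 * X ^ l`: those with `l > 0` lie in `z I`, those
with `l = 0` already come from `idealDeg`. -/
theorem extDeg_le {n : ℕ} {p : (TensorRing S V)[X]} (hp : p ∈ α.extDeg n) :
    p ∈ α.extIdeal ∧ p ∈ polyDeg S V n ∧ ∃ x ∈ α.idealDeg n, ∃ q ∈ α.extIdeal,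
      p = x.2 + X * q := by
  induction hp using AddSubgroup.closure_induction with
  | mem p hp =>
    obtain ⟨m, l, rfl, x, hx, rfl⟩ := hp
    refine ⟨TwoSidedIdeal.mul_mem_right _ _ _ (snd_mem_extIdeal hx),
      mul_X_pow_mem_polyDeg l (snd_mem_of_mem_idealDeg hx), ?_⟩
    cases l with
    | zero => exact ⟨x, hx, 0, zero_mem _, by simp⟩
    | succ l =>
      refine ⟨0, zero_mem _, x.2 * X ^ l, TwoSidedIdeal.mul_mem_right _ _ _ (snd_mem_extIdeal hx),
        ?_⟩
      rw [pow_succ, Prod.snd_zero, zero_add, X_mul, mul_assoc]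
  | zero => exact ⟨zero_mem _, zero_mem _, 0, zero_mem _, 0, zero_mem _, by simp⟩
  | add p q _ _ hp hq =>
    obtain ⟨h1, h2, x, hx, a, ha, h3⟩ := hp
    obtain ⟨h1', h2', x', hx', a', ha', h3'⟩ := hq
    refine ⟨add_mem h1 h1', add_mem h2 h2', x + x', add_mem hx hx', a + a', add_mem ha ha', ?_⟩
    rw [h3, h3', Prod.snd_add, mul_add]
    abel
  | neg p _ hp =>
    obtain ⟨h1, h2, x, hx, a, ha, h3⟩ := hp
    refine ⟨neg_mem h1, neg_mem h2, -x, neg_mem hx, -a, neg_mem ha, ?_⟩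
    rw [h3, Prod.snd_neg, mul_neg]
    abel

theorem polyProj_mem_extIdeal (n : ℕ) {p : (TensorRing S V)[X]} (hp : p ∈ α.extIdeal) :
    polyProj S V n p ∈ α.extIdeal := by
  have hp' := mem_iSup_extDeg hp
  clear hp
  induction hp' using AddSubgroup.iSup_induction' with
  | hp m q hq =>
    rw [polyProj_of_mem n (extDeg_le hq).2.1]
    split_ifs
    · exact (extDeg_le hq).1
    · exact zero_mem _
  | h1 => simp
  | hadd q q' _ _ hq hq' => rw [map_add]; exact add_mem hq hq'

theorem exists_finsupp_of_mem_extIdeal {p : (TensorRing S V)[X]} (hp : p ∈ α.extIdeal) :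
    ∃ g : ℕ →₀ TensorRing S V × (TensorRing S V)[X], (∀ n, g n ∈ α.idealDeg n) ∧
      ∃ q ∈ α.extIdeal, p = (g.sum fun _ x => x.2) + X * q := by
  have hp' := mem_iSup_extDeg hp
  clear hp
  induction hp' using AddSubgroup.iSup_induction' with
  | hp m p hp =>
    obtain ⟨-, -, x, hx, q, hq, rfl⟩ := extDeg_le hp
    refine ⟨Finsupp.single m x, fun n => ?_, q, hq, by simp⟩
    rw [Finsupp.single_apply]
    split_ifs with h
    · exact h ▸ hx
    · exact zero_mem _
  | h1 => exact ⟨0, fun _ => zero_mem _, 0, zero_mem _, by simp⟩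
  | hadd p p' _ _ hp hp' =>
    obtain ⟨g, hg, q, hq, rfl⟩ := hp
    obtain ⟨g', hg', q', hq', rfl⟩ := hp'
    refine ⟨g + g', fun n => add_mem (hg n) (hg' n), q + q', add_mem hq hq', ?_⟩
    rw [Finsupp.sum_add_index' (by simp) (by simp), mul_add]
    abel

variable (α)

/-- Relations of degree `n` whose leading part vanishes are divisible by `z` in the ideal of
relations. -/
def FilteredMap.IsDivisible (n : ℕ) : Prop :=
  ∀ q, ((0 : TensorRing S V), q) ∈ α.idealDeg n → ∃ j ∈ α.extIdeal, q = X * j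

theorem FilteredMap.mk_eq_zero {p : (TensorRing S V)[X]} :
    α.extIdeal.ringCon.mk' p = 0 ↔ p ∈ α.extIdeal := by
  rw [TwoSidedIdeal.mem_iff]
  exact RingCon.eq α.extIdeal.ringCon

theorem FilteredMap.z_mul_mk (p : (TensorRing S V)[X]) :
    α.z * α.extIdeal.ringCon.mk' p = α.extIdeal.ringCon.mk' (X * p) := (map_mul _ _ _).symm

theorem FilteredMap.mk_mem_degD {n : ℕ} {p : (TensorRing S V)[X]} (hp : p ∈ polyDeg S V n) :
    α.extIdeal.ringCon.mk' p ∈ α.degD n := by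
  induction hp using AddSubgroup.closure_induction with
  | mem p hp =>
    obtain ⟨i, j, h, t, ht, rfl⟩ := hp
    exact AddSubgroup.subset_closure ⟨i, j, h, t, ht, rfl⟩
  | zero => rw [map_zero]; exact zero_mem _
  | add p q _ _ hp hq => rw [map_add]; exact add_mem hp hq
  | neg p _ hp => rw [map_neg]; exact neg_mem hp

variable {α}

/-- Dividing `q` by `z` lowers the degree by one and gives an element annihilated by `z` in `D`.
This is the shift by `1` in the definition of `complexity`. -/
theorem FilteredMap.IsRegularUpTo.isDivisible {c : EReal} (h : α.IsRegularUpTo c) {n : ℕ}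
    (hn : (n : EReal) ≤ c) : α.IsDivisible (n + 1) := by
  intro q hq
  have h0 : q.coeff 0 = 0 := snd_coeff_zero hq
  have hq' : q = X * divX q := by
    conv_lhs => rw [← divX_mul_X_add q, h0, C_0, add_zero, ← X_mul]
  refine ⟨divX q, ?_, hq'⟩
  rw [← α.mk_eq_zero]
  refine h n hn _ (α.mk_mem_degD (divX_mem_polyDeg (snd_mem_of_mem_idealDeg hq))) ?_
  rw [α.z_mul_mk, ← hq', α.mk_eq_zero]
  exact snd_mem_extIdeal hq

theorem eq_zero_of_sum_fst_eq_zero {g : ℕ →₀ TensorRing S V × (TensorRing S V)[X]}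
    (hg : ∀ n, (g n).1 ∈ deg S V n) (h : (g.sum fun _ x => x.1) = 0) (n : ℕ) : (g n).1 = 0 := by
  have := congrArg (GradedRing.proj (deg S V) n) h
  rw [map_finsuppSum, map_zero, Finsupp.sum, Finset.sum_congr rfl
    (fun m _ => proj_of_mem n (hg m)), Finset.sum_ite_eq'] at this
  split_ifs at this with hn
  · exact this
  · rw [Finsupp.notMem_support_iff.mp hn]; rfl

/-- The constant term of `X * p` is `0`, so the leading parts of its expression modulo `z I` sum to
`0`, and each vanishes since they have distinct degrees. Divisibility puts `X * p` in `z I`, and `X`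
cancels in the polynomial ring. -/
theorem mem_extIdeal_of_X_mul_mem (h : ∀ n, α.IsDivisible n) {p : (TensorRing S V)[X]}
    (hp : X * p ∈ α.extIdeal) : p ∈ α.extIdeal := by
  obtain ⟨g, hg, q, hq, hpq⟩ := exists_finsupp_of_mem_extIdeal hp
  have h0 : (g.sum fun _ x => x.1) = 0 := by
    have := congrArg (fun p => coeff p 0) hpq
    simp only [coeff_X_mul_zero, coeff_add, add_zero, Finsupp.sum, finsetSum_coeff] at this
    rw [Finsupp.sum, this]
    exact Finset.sum_congr rfl fun n _ => (snd_coeff_zero (hg n)).symm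
  have h1 := eq_zero_of_sum_fst_eq_zero (fun n => fst_mem_of_mem_idealDeg (hg n)) h0
  have h2 : ∀ n, ∃ j ∈ α.extIdeal, (g n).2 = X * j := fun n => by
    refine h n _ ?_
    rw [← h1 n]
    exact hg n
  choose j hj hgj using h2
  have h3 : X * p = X * (g.sum (fun n _ => j n) + q) := by
    rw [hpq, mul_add, Finsupp.mul_sum]
    congr 1
    exact Finset.sum_congr rfl fun n _ => hgj n
  have h4 : p = g.sum (fun n _ => j n) + q := by
    ext n
    have := congrArg (fun p => coeff p (n + 1)) h3
    simpa only [coeff_X_mul] using this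
  rw [h4]
  exact add_mem (sum_mem fun n _ => hj n) hq

theorem isRegular_z (h : ∀ n, α.IsDivisible n) : IsRegular α.z := by
  have key : ∀ d : α.D, α.z * d = 0 → d = 0 := by
    intro d hd
    obtain ⟨p, rfl⟩ := RingCon.mk'_surjective α.extIdeal.ringCon d
    rw [α.z_mul_mk, α.mk_eq_zero] at hd
    exact α.mk_eq_zero.mpr (mem_extIdeal_of_X_mul_mem h hd)
  have comm : ∀ d : α.D, d * α.z = α.z * d := by
    intro d
    obtain ⟨p, rfl⟩ := RingCon.mk'_surjective α.extIdeal.ringCon d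
    rw [α.z_mul_mk, X_mul]
    exact (map_mul _ _ _).symm
  refine ⟨isLeftRegular_iff_right_eq_zero_of_mul.mpr key,
    isRightRegular_iff_left_eq_zero_of_mul.mpr fun d hd => key d ?_⟩
  rw [← comm, hd]

theorem isRegularUpTo_of_isRegular (h : IsRegular α.z) (c : EReal) : α.IsRegularUpTo c :=
  fun _ _ d _ hd => isLeftRegular_iff_right_eq_zero_of_mul.mp h.left d hd

section projective

variable [SMulCommClass S Sᵐᵒᵖ V]

/-- Expanding the last factor from `V` along the dual basis makes the leading parts of the
coefficients functions of `x.1` alone. In particular they all vanish when `x.1 = 0`, which is what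
`IsDivisible.of_mem_rightDeg` needs. -/
theorem exists_finsupp_of_mem_rightDeg {c : V →ₗ[S] V →₀ S}
    (hc : ∀ v, Finsupp.linearCombination S id (c v) = v) {n : ℕ}
    {x} (hx : x ∈ α.rightDeg (n + 1)) : ∃ g : V →₀ TensorRing S V × (TensorRing S V)[X],
      (∀ v, g v ∈ α.idealDeg n) ∧ (∀ v, (g v).1 = rightCoord c x.1 v) ∧
        x = g.sum fun v y => pairMul (ι S V v) y := by
  induction hx using Submodule.span_induction with
  | mem x hx =>
    obtain ⟨m, hm, y, hy, v, rfl⟩ := hx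
    obtain rfl : m = n := by omega
    refine ⟨(c v).mapRange (fun s => pairMul (scalar S V s) y) (by simp [pairMul_zero]),
      fun w => ?_, fun w => ?_, ?_⟩
    · simpa using pairMul_mem_idealDeg (scalar_mem (c v w)) hy
    · rw [Finsupp.mapRange_apply, pairMul_apply, pairMul_apply, rightCoord_mul_ι]
    · rw [Finsupp.sum_mapRange_index (by simp)]
      simp only [← pairMul_mul]
      conv_lhs => rw [← sum_scalar_mul_ι hc v]
      simp [pairMul_apply, Finsupp.sum, Finset.mul_sum, Prod.ext_iff, Prod.fst_sum, Prod.snd_sum]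
  | zero => exact ⟨0, fun _ => zero_mem _, by simp, by simp⟩
  | add x y _ _ hx hy =>
    obtain ⟨g, h1, h2, h3⟩ := hx
    obtain ⟨g', h1', h2', h3'⟩ := hy
    refine ⟨g + g', fun v => add_mem (h1 v) (h1' v), fun v => ?_, ?_⟩
    · rw [Prod.fst_add, map_add, Finsupp.add_apply, Finsupp.add_apply, Prod.fst_add, h2, h2']
    · rw [Finsupp.sum_add_index' (by simp) (by simp), ← h3, ← h3']
  | smul s x hx hg =>
    obtain ⟨g, h1, h2, h3⟩ := hg
    have hx1 : x.1 ∈ augIdeal S V := deg_succ_le_augIdeal (n := n)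
      (fst_mem_of_mem_idealDeg (rightDeg_le_idealDeg (α := α) _ hx))
    refine ⟨g.mapRange (s • ·) (smul_zero s), fun v => Submodule.smul_mem _ s (h1 v),
      fun v => ?_, ?_⟩
    · rw [Prod.smul_fst, rightCoord_smul _ _ hx1, Finsupp.mapRange_apply, Prod.smul_fst, h2]
    · rw [Finsupp.sum_mapRange_index (by simp)]
      conv_lhs => rw [h3, Finsupp.smul_sum]
      simp only [LinearMap.map_smul_of_tower]

theorem FilteredMap.IsDivisible.of_mem_rightDeg [Module.Projective S V] {n : ℕ}
    (h : α.IsDivisible n) {q : (TensorRing S V)[X]}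
    (hq : ((0 : TensorRing S V), q) ∈ α.rightDeg (n + 1)) : ∃ j ∈ α.extIdeal, q = X * j := by
  obtain ⟨c, hc⟩ := Module.projective_def'.mp (inferInstance : Module.Projective S V)
  obtain ⟨g, h1, h2, h3⟩ := exists_finsupp_of_mem_rightDeg (DFunLike.congr_fun hc) hq
  have h4 : ∀ v, ∃ j ∈ α.extIdeal, (g v).2 = X * j := fun v => by
    refine h _ ?_
    have : (g v).1 = 0 := by rw [h2 v, map_zero, Finsupp.zero_apply]
    rw [← this]
    exact h1 v
  choose j hj hgj using h4
  refine ⟨g.sum fun v _ => j v * C (ι S V v),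
    sum_mem fun v _ => TwoSidedIdeal.mul_mem_right _ _ _ (hj v), ?_⟩
  have := congrArg Prod.snd h3
  rw [Finsupp.sum, Prod.snd_sum] at this
  rw [Finsupp.mul_sum]
  refine this.trans (Finset.sum_congr rfl fun v _ => ?_)
  rw [pairMul_apply, hgj v, mul_assoc]

end projective

variable (α)

/-- The pairs that are trivial modulo the products of relations with `V` on the right and the
multiples of `z`. -/
noncomputable def FilteredMap.nullMod :
    Submodule (TensorRing S V) (TensorRing S V × (TensorRing S V)[X]) :=
  Submodule.span _ (⋃ n, (α.rightDeg n : Set _)) ⊔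
    { carrier := {x | x.1 = 0 ∧ ∃ j ∈ α.extIdeal, x.2 = X * j}
      zero_mem' := ⟨rfl, 0, zero_mem _, by simp⟩
      add_mem' := by
        rintro x y ⟨hx, j, hj, h⟩ ⟨hy, j', hj', h'⟩
        exact ⟨by simp [hx, hy], j + j', add_mem hj hj', by simp [h, h', mul_add]⟩
      smul_mem' := by
        rintro t x ⟨hx, j, hj, h⟩
        exact ⟨by simp [hx], C t * j, TwoSidedIdeal.mul_mem_left _ _ _ hj, by
          rw [Prod.smul_snd, smul_eq_C_mul, h, ← mul_assoc, ← mul_assoc, X_mul]⟩ }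

variable {α}

theorem mem_nullMod_of_mem_rightDeg {n : ℕ} {x} (hx : x ∈ α.rightDeg n) : x ∈ α.nullMod :=
  Submodule.mem_sup_left (Submodule.subset_span (Set.mem_iUnion.mpr ⟨n, hx⟩))

theorem mem_nullMod_of_eq_X_mul {x : TensorRing S V × (TensorRing S V)[X]} (h : x.1 = 0) {j}
    (hj : j ∈ α.extIdeal) (hx : x.2 = X * j) : x ∈ α.nullMod :=
  Submodule.mem_sup_right ⟨h, j, hj, hx⟩

/-- The projection onto the component of degree `n` of `T_S(V) × T_S(V)[z]`. -/
noncomputable def pairProj (S : Type u) (V : Type v) [Ring S] [AddCommGroup V] [Module S V]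
    [Module Sᵐᵒᵖ V] (n : ℕ) :
    TensorRing S V × (TensorRing S V)[X] →+ TensorRing S V × (TensorRing S V)[X] :=
  (GradedRing.proj (deg S V) n).prodMap (polyProj S V n)

theorem pairProj_of_mem {m : ℕ} (n : ℕ) {x} (hx : x ∈ α.idealDeg m) :
    pairProj S V n x = if m = n then x else 0 := by
  change (GradedRing.proj (deg S V) n x.1, polyProj S V n x.2) = _
  rw [proj_of_mem n (fst_mem_of_mem_idealDeg hx), polyProj_of_mem n (snd_mem_of_mem_idealDeg hx)]
  split_ifs <;> rfl

theorem pairProj_mem_rightDeg (n : ℕ) {x : TensorRing S V × (TensorRing S V)[X]}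
    (hx : x ∈ Submodule.span (TensorRing S V) (⋃ n, (α.rightDeg n : Set _))) :
    pairProj S V n x ∈ α.rightDeg n := by
  suffices ∀ t : TensorRing S V, pairProj S V n (t • x) ∈ α.rightDeg n by simpa using this 1
  induction hx using Submodule.span_induction with
  | mem x hx =>
    obtain ⟨m, hm⟩ := Set.mem_iUnion.mp hx
    intro t
    induction t using DirectSum.Decomposition.inductionOn (deg S V) with
    | zero => simp
    | add t t' ht ht' => rw [add_smul, map_add]; exact add_mem ht ht'
    | homogeneous t =>
      have := smul_mem_rightDeg t.2 hm
      rw [pairProj_of_mem n (rightDeg_le_idealDeg _ this)]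
      split_ifs with h
      · exact h ▸ this
      · exact zero_mem _
  | zero => simp
  | add x y _ _ hx hy => intro t; rw [smul_add, map_add]; exact add_mem (hx t) (hy t)
  | smul s x _ hx => intro t; rw [smul_smul]; exact hx _

/-- Both summands of `nullMod` are homogeneous, so one projects to degree `n + 1`; on `X * j` this
is `X` times the projection of `j` to degree `n`. -/
theorem exists_mem_rightDeg_of_mem_nullMod {n : ℕ} {q : (TensorRing S V)[X]}
    (hq : q ∈ polyDeg S V (n + 1)) (h : ((0 : TensorRing S V), q) ∈ α.nullMod) :
    ∃ q' j, (0, q') ∈ α.rightDeg (n + 1) ∧ j ∈ α.extIdeal ∧ q = q' + X * j := by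
  obtain ⟨y, hy, x, ⟨hx, j, hj, hxj⟩, hxy⟩ := Submodule.mem_sup.mp h
  obtain ⟨y1, y2⟩ := y
  obtain ⟨x1, x2⟩ := x
  obtain rfl : x1 = 0 := hx
  obtain rfl : x2 = X * j := hxj
  obtain ⟨h1, rfl⟩ := Prod.ext_iff.mp hxy
  obtain rfl : y1 = 0 := by simpa using h1
  refine ⟨polyProj S V (n + 1) y2, polyProj S V n j, ?_, polyProj_mem_extIdeal n hj, ?_⟩
  · have := pairProj_mem_rightDeg (n + 1) hy
    change (GradedRing.proj (deg S V) (n + 1) 0, polyProj S V (n + 1) y2) ∈ _ at this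
    rwa [map_zero] at this
  · have := polyProj_of_mem (n + 1) hq
    rw [if_pos rfl] at this
    conv_lhs => rw [← this]
    rw [← polyProj_succ_X_mul, ← map_add]
    rfl

theorem FilteredMap.IsDivisible.of_mem_nullMod [SMulCommClass S Sᵐᵒᵖ V] [Module.Projective S V]
    {n : ℕ} (h : α.IsDivisible n) {q : (TensorRing S V)[X]} (hq : q ∈ polyDeg S V (n + 1))
    (hq' : ((0 : TensorRing S V), q) ∈ α.nullMod) : ∃ j ∈ α.extIdeal, q = X * j := by
  obtain ⟨q', j, h1, hj, rfl⟩ := exists_mem_rightDeg_of_mem_nullMod hq hq'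
  obtain ⟨j', hj', rfl⟩ := h.of_mem_rightDeg h1
  exact ⟨j' + j, add_mem hj' hj, (mul_add _ _ _).symm⟩

/-- A relation times a relation is trivial. -/
theorem smul_pair_mem_nullMod {n j : ℕ} {x} (hx : x ∈ α.idealDeg n) {r : R.toSubmodule}
    (hr : (r : TensorRing S V) ∈ deg S V (j + 1)) : x.1 • α.pair (j + 1) r ∈ α.nullMod := by
  have h1 := mem_nullMod_of_mem_rightDeg (pairMul_mem_rightDeg hr hx)
  obtain ⟨p, hp⟩ : ∃ p, x.2 - C x.1 = X * p := by
    refine ⟨divX (x.2 - C x.1), ?_⟩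
    conv_lhs => rw [← divX_mul_X_add (x.2 - C x.1)]
    simp [snd_coeff_zero hx, X_mul]
  obtain ⟨b, hb⟩ : ∃ b, α.homog (j + 1) r - C (r : TensorRing S V) = X * b := by
    refine ⟨divX (α.homog (j + 1) r - C (r : TensorRing S V)), ?_⟩
    conv_lhs => rw [← divX_mul_X_add (α.homog (j + 1) r - C (r : TensorRing S V))]
    simp [α.homog_coeff_zero hr, X_mul]
  -- With `x.2 = x.1 + z p` and `α_z(r) = r + z b`, one has `x.1 α_z(r) - x.2 r = z (x.2 b - p
  -- α_z(r))`. So multiplying the leading part of `x` by the lift of `r`, or the lift of `x` by `r`,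
  -- agrees modulo `z I`; the latter product ends in `A¹` because `r` has positive degree.
  have h2 : x.1 • α.pair (j + 1) r - pairMul (r : TensorRing S V) x ∈ α.nullMod := by
    refine mem_nullMod_of_eq_X_mul (j := x.2 * b - p * α.homog (j + 1) r) ?_ ?_ ?_
    · simp [FilteredMap.pair_apply, pairMul_apply]
    · exact sub_mem (TwoSidedIdeal.mul_mem_right _ _ _ (snd_mem_extIdeal hx))
        (TwoSidedIdeal.mul_mem_left _ _ _ (α.homog_mem_extIdeal hr))
    · have e1 : X * (x.2 * b) = x.2 * (X * b) := by
        rw [← mul_assoc, ← mul_assoc, X_mul]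
      rw [mul_sub, e1, ← hb, ← mul_assoc, ← hp, Prod.snd_sub, Prod.smul_snd, smul_eq_C_mul,
        pairMul_apply, FilteredMap.pair_apply]
      noncomm_ring
  have := add_mem h2 h1
  rwa [sub_add_cancel] at this

end divisibility

/-! ### The ideal `I_A`, its generators `R`, and the kernel of `d₁`. -/

section relations

variable {S : Type u} {A : Type v} [Ring S] [Ring A] [Module S A] [IsScalarTower S A A]
  {𝒜 : ℕ → Submodule S A} [GradedRing 𝒜]

open TensorRing Polynomial

instance : SMulCommClass S Sᵐᵒᵖ (DegOne 𝒜) where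
  smul_comm s t x := Subtype.ext (smul_mul_assoc s (DegOne.incl 𝒜 x) (t.unop • (1 : A))).symm

theorem piA_scalar (s : S) : piA 𝒜 (scalar S (DegOne 𝒜) s) = s • 1 := lift_scalar _ _ _ _ _

theorem piA_ι (x : DegOne 𝒜) : piA 𝒜 (ι S (DegOne 𝒜) x) = DegOne.incl 𝒜 x := lift_ι _ _ _ _ _

omit [IsScalarTower S A A] [GradedRing 𝒜] in
theorem incl_mem (x : DegOne 𝒜) : DegOne.incl 𝒜 x ∈ 𝒜 1 := x.2

omit [IsScalarTower S A A] [GradedRing 𝒜] in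
theorem exists_incl_eq {b : A} (hb : b ∈ 𝒜 1) : ∃ v : DegOne 𝒜, DegOne.incl 𝒜 v = b :=
  ⟨(⟨b, hb⟩ : 𝒜 1), rfl⟩

theorem piA_smul (s : S) (t : TA 𝒜) : piA 𝒜 (s • t) = s • piA 𝒜 t := by
  rw [TensorRing.smul_def, map_mul, piA_scalar, smul_one_mul]

theorem piA_mem {n : ℕ} {t : TA 𝒜} (ht : t ∈ deg S (DegOne 𝒜) n) : piA 𝒜 t ∈ 𝒜 n := by
  induction n generalizing t with
  | zero =>
    obtain ⟨s, rfl⟩ := Submodule.mem_span_singleton.mp ht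
    rw [piA_smul, map_one]
    exact Submodule.smul_mem _ _ SetLike.GradedOne.one_mem
  | succ n ih =>
    rw [deg] at ht
    induction ht using Submodule.span_induction with
    | mem x hx =>
      obtain ⟨t, ht, v, rfl⟩ := hx
      rw [map_mul, piA_ι]
      exact SetLike.mul_mem_graded (ih ht) (incl_mem v)
    | zero => simp
    | add x y _ _ hx hy => rw [map_add]; exact add_mem hx hy
    | smul s x _ hx => rw [piA_smul]; exact Submodule.smul_mem _ _ hx

theorem mem_relIdeal {t : TA 𝒜} : t ∈ relIdeal 𝒜 ↔ piA 𝒜 t = 0 := Iff.rfl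

theorem proj_piA (n : ℕ) (t : TA 𝒜) :
    GradedRing.proj 𝒜 n (piA 𝒜 t) = piA 𝒜 (GradedRing.proj (deg S (DegOne 𝒜)) n t) := by
  induction t using DirectSum.Decomposition.inductionOn (deg S (DegOne 𝒜)) with
  | zero => simp
  | add x y hx hy => simp only [map_add, hx, hy]
  | @homogeneous m t =>
    rw [proj_of_mem n t.2, GradedRing.proj_apply]
    split_ifs with h
    · subst h
      exact DirectSum.decompose_of_mem_same _ (piA_mem t.2)
    · rw [map_zero]
      exact DirectSum.decompose_of_mem_ne _ (piA_mem t.2) h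

theorem proj_mem_relIdeal (n : ℕ) {t : TA 𝒜} (ht : t ∈ relIdeal 𝒜) :
    GradedRing.proj (deg S (DegOne 𝒜)) n t ∈ relIdeal 𝒜 := by
  rw [mem_relIdeal] at ht ⊢
  rw [← proj_piA, ht, map_zero]

theorem mul_mem_relIdeal_left (a : TA 𝒜) {t : TA 𝒜} (ht : t ∈ relIdeal 𝒜) :
    a * t ∈ relIdeal 𝒜 := by
  rw [mem_relIdeal] at ht ⊢
  rw [map_mul, ht, mul_zero]

theorem mul_mem_relIdeal_right (a : TA 𝒜) {t : TA 𝒜} (ht : t ∈ relIdeal 𝒜) :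
    t * a ∈ relIdeal 𝒜 := by
  rw [mem_relIdeal] at ht ⊢
  rw [map_mul, ht, zero_mul]

theorem exists_piA_eq (hconn : IsConnectedGrading 𝒜) (hstrong : IsStronglyGraded 𝒜) {n : ℕ} {a : A}
    (ha : a ∈ 𝒜 n) : ∃ t ∈ deg S (DegOne 𝒜) n, piA 𝒜 t = a := by
  induction n generalizing a with
  | zero =>
    obtain ⟨s, rfl⟩ : a ∈ Set.range (fun s : S => s • (1 : A)) := hconn.2 ▸ ha
    exact ⟨scalar S (DegOne 𝒜) s, scalar_mem s, piA_scalar s⟩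
  | succ n ih =>
    have ha' : a ∈ AddSubgroup.closure {x : A | ∃ a ∈ 𝒜 n, ∃ b ∈ 𝒜 1, x = a * b} := by
      rw [hstrong n 1]
      exact ha
    clear ha
    induction ha' using AddSubgroup.closure_induction with
    | mem a ha =>
      obtain ⟨a, ha, b, hb, rfl⟩ := ha
      obtain ⟨t, ht, rfl⟩ := ih ha
      obtain ⟨v, rfl⟩ := exists_incl_eq hb
      exact ⟨t * ι S (DegOne 𝒜) v, mul_ι_mem ht _, by rw [map_mul, piA_ι]⟩
    | zero => exact ⟨0, zero_mem _, map_zero _⟩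
    | add x y _ _ hx hy =>
      obtain ⟨t, ht, rfl⟩ := hx
      obtain ⟨t', ht', rfl⟩ := hy
      exact ⟨t + t', add_mem ht ht', map_add _ _ _⟩
    | neg x _ hx =>
      obtain ⟨t, ht, rfl⟩ := hx
      exact ⟨-t, neg_mem ht, map_neg _ _⟩

theorem piA_surjective (hconn : IsConnectedGrading 𝒜) (hstrong : IsStronglyGraded 𝒜) :
    Function.Surjective (piA 𝒜) := by
  intro a
  induction a using DirectSum.Decomposition.inductionOn 𝒜 with
  | zero => exact ⟨0, map_zero _⟩
  | add a b ha hb =>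
    obtain ⟨t, rfl⟩ := ha
    obtain ⟨t', rfl⟩ := hb
    exact ⟨t + t', map_add _ _ _⟩
  | homogeneous a =>
    obtain ⟨t, -, ht⟩ := exists_piA_eq hconn hstrong a.2
    exact ⟨t, ht⟩

theorem eq_zero_of_mem_relIdeal (hconn : IsConnectedGrading 𝒜) {t : TA 𝒜}
    (ht : t ∈ relIdeal 𝒜) (h : t ∈ deg S (DegOne 𝒜) 0) : t = 0 := by
  obtain ⟨s, rfl⟩ := Submodule.mem_span_singleton.mp h
  rw [mem_relIdeal, piA_smul, map_one] at ht
  have : s = 0 := hconn.1 (by simpa using ht)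
  rw [this, zero_smul]

variable {R : GradedSubbimodule S (DegOne 𝒜)} (hR : IsBimoduleOfRelations 𝒜 R)
include hR

theorem coe_mem_relIdeal (r : R.toSubmodule) : (r : TA 𝒜) ∈ relIdeal 𝒜 :=
  hR.2 ▸ Submodule.mem_sup_left r.2

theorem relation_eq_zero (hconn : IsConnectedGrading 𝒜) {r : R.toSubmodule}
    (hr : (r : TA 𝒜) ∈ deg S (DegOne 𝒜) 0) : r = 0 :=
  Subtype.ext (eq_zero_of_mem_relIdeal hconn (coe_mem_relIdeal hR r) hr)

variable (α : FilteredMap R)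

theorem fst_mem_relIdeal {n : ℕ} {x} (hx : x ∈ α.idealDeg n) : x.1 ∈ relIdeal 𝒜 := by
  refine idealDeg_induction (p := fun x => x.1 ∈ relIdeal 𝒜) (zero_mem _)
    (fun x y hx hy => add_mem hx hy) ?_ hx
  rintro i j k rfl a ha r hr b hb
  exact mul_mem_relIdeal_right _ (mul_mem_relIdeal_left _ (coe_mem_relIdeal hR r))

omit hR in
theorem proj_ι_mul (n : ℕ) (v : DegOne 𝒜) (t : TA 𝒜) :
    GradedRing.proj (deg S (DegOne 𝒜)) (n + 1) (ι S (DegOne 𝒜) v * t) = ι S (DegOne 𝒜) v * GradedRing.proj (deg S (DegOne 𝒜)) n t ∧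
    GradedRing.proj (deg S (DegOne 𝒜)) (n + 1) (t * ι S (DegOne 𝒜) v) = GradedRing.proj (deg S (DegOne 𝒜)) n t * ι S (DegOne 𝒜) v ∧
    GradedRing.proj (deg S (DegOne 𝒜)) 0 (ι S (DegOne 𝒜) v * t) = 0 ∧
    GradedRing.proj (deg S (DegOne 𝒜)) 0 (t * ι S (DegOne 𝒜) v) = 0 := by
  simp only [GradedRing.proj_apply]
  refine ⟨?_, ?_, ?_, ?_⟩
  · rw [add_comm n 1]
    exact DirectSum.coe_decompose_mul_add_of_left_mem _ (ι_mem v)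
  · exact DirectSum.coe_decompose_mul_add_of_right_mem _ (ι_mem v)
  · exact DirectSum.coe_decompose_mul_of_left_mem_of_not_le _ (ι_mem v) (by omega)
  · exact DirectSum.coe_decompose_mul_of_right_mem_of_not_le _ (ι_mem v) (by omega)

omit hR in
theorem ι_smul_mem_idealDeg {n : ℕ} (v : DegOne 𝒜) {x} (hx : x ∈ α.idealDeg n) :
    ι S (DegOne 𝒜) v • x ∈ α.idealDeg (n + 1) := by
  rw [add_comm]
  exact smul_mem_idealDeg (ι_mem v) hx

/-- `R` generates `I_A` as an ideal, by a graded Nakayama argument: in degree `n` the part `A¹ I_A +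
I_A A¹` comes from `I_A` in degree `n - 1`. -/
theorem proj_mem_map_idealDeg {n : ℕ} {t : TA 𝒜} (ht : t ∈ relIdeal 𝒜) :
    GradedRing.proj (deg S (DegOne 𝒜)) n t ∈ (α.idealDeg n).map (LinearMap.fst S _ _) := by
  induction n using Nat.strong_induction_on generalizing t with
  | _ n ih =>
    -- Phrased as an inclusion of submodules, the claim can be checked on the summands of `I_A = R +
    -- A¹ I_A + I_A A¹`.
    change t ∈ ((α.idealDeg n).map (LinearMap.fst S _ _)).comap (tensorComponent S (DegOne 𝒜) n)
    revert t
    rw [← SetLike.le_def, ← hR.2]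
    refine sup_le (fun r hr => ?_) (sup_le (Submodule.span_le.mpr ?_) (Submodule.span_le.mpr ?_))
    · refine ⟨α.pair n (R.component n ⟨r, hr⟩), leftDeg_le_idealDeg n (Submodule.subset_span
        ⟨0, n, zero_add n, 1, SetLike.GradedOne.one_mem, _, component_mem n _,
          (one_smul _ _).symm⟩), rfl⟩
    · rintro _ ⟨v, t, ht, rfl⟩
      change GradedRing.proj (deg S (DegOne 𝒜)) n (ι S (DegOne 𝒜) v * t) ∈
        (α.idealDeg n).map (LinearMap.fst S _ _)
      cases n with
      | zero => rw [(proj_ι_mul 0 v t).2.2.1]; exact zero_mem _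
      | succ n =>
        rw [(proj_ι_mul n v t).1]
        obtain ⟨x, hx, h⟩ := ih n n.lt_succ_self ht
        exact ⟨ι S (DegOne 𝒜) v • x, ι_smul_mem_idealDeg α v hx, congrArg (ι S (DegOne 𝒜) v * ·) h⟩
    · rintro _ ⟨v, t, ht, rfl⟩
      change GradedRing.proj (deg S (DegOne 𝒜)) n (t * ι S (DegOne 𝒜) v) ∈
        (α.idealDeg n).map (LinearMap.fst S _ _)
      cases n with
      | zero => rw [(proj_ι_mul 0 v t).2.2.2]; exact zero_mem _
      | succ n =>
        rw [(proj_ι_mul n v t).2.1]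
        obtain ⟨x, hx, h⟩ := ih n n.lt_succ_self ht
        exact ⟨pairMul (ι S (DegOne 𝒜) v) x, pairMul_mem_idealDeg (ι_mem v) hx, congrArg (· * ι S (DegOne 𝒜) v) h⟩

theorem exists_mem_idealDeg {n : ℕ} {t : TA 𝒜} (ht : t ∈ relIdeal 𝒜) (h : t ∈ deg S (DegOne 𝒜) n) :
    ∃ x ∈ α.idealDeg n, x.1 = t := by
  have := proj_mem_map_idealDeg hR α (n := n) ht
  rw [proj_of_mem n h, if_pos rfl] at this
  exact this

/-- The map `T_A → A ⊗_S A¹` that sends `t v` to `π(t) ⊗ v`. -/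
noncomputable def cutA (𝒜 : ℕ → Submodule S A) [GradedRing 𝒜] :
    TA 𝒜 →ₗ[S] TensorOver S A (DegOne 𝒜) :=
  cut (piA 𝒜) piA_scalar

omit hR in
theorem cutA_mul_ι (t : TA 𝒜) (v : DegOne 𝒜) :
    cutA 𝒜 (t * ι S (DegOne 𝒜) v) = tmul S (piA 𝒜 t) v := cut_mul_ι _ _ _ _

omit hR in
theorem cutA_mul (t : TA 𝒜) {x : TA 𝒜} (hx : x ∈ augIdeal S (DegOne 𝒜)) :
    cutA 𝒜 (t * x) = piA 𝒜 t • cutA 𝒜 x := cut_mul _ _ _ hx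

omit hR in
theorem d₁_cutA {t : TA 𝒜} (ht : t ∈ augIdeal S (DegOne 𝒜)) : d₁ 𝒜 (cutA 𝒜 t) = piA 𝒜 t := by
  refine augIdeal_induction (p := fun t => d₁ 𝒜 (cutA 𝒜 t) = piA 𝒜 t) (by simp)
    (fun t v => ?_) (fun x y _ _ hx hy => by simp only [map_add, hx, hy]) ht
  rw [cutA_mul_ι, d₁_tmul, map_mul, piA_ι]

omit hR in
theorem cutA_mem {n : ℕ} {t : TA 𝒜} (ht : t ∈ deg S (DegOne 𝒜) (n + 1)) :
    cutA 𝒜 t ∈ tensorDeg 𝒜 (degOneGrading 𝒜) (n + 1) := by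
  rw [deg] at ht
  suffices ∀ s : S, cutA 𝒜 (s • t) ∈ tensorDeg 𝒜 (degOneGrading 𝒜) (n + 1) by
    simpa using this 1
  induction ht using Submodule.span_induction with
  | mem x hx =>
    obtain ⟨t, ht, v, rfl⟩ := hx
    intro s
    rw [← smul_mul_assoc, cutA_mul_ι]
    exact tmul_mem_tensorDeg rfl (piA_mem (Submodule.smul_mem _ s ht))
      (by simp [degOneGrading])
  | zero => simp
  | add x y _ _ hx hy => intro s; rw [smul_add, map_add]; exact add_mem (hx s) (hy s)
  | smul s x _ hx => intro s'; rw [smul_smul]; exact hx _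

omit hR in
theorem exists_cutA_eq (hconn : IsConnectedGrading 𝒜) (hstrong : IsStronglyGraded 𝒜) {n : ℕ}
    {y : TensorOver S A (DegOne 𝒜)} (hy : y ∈ tensorDeg 𝒜 (degOneGrading 𝒜) n) :
    ∃ t ∈ deg S (DegOne 𝒜) n, t ∈ augIdeal S (DegOne 𝒜) ∧ cutA 𝒜 t = y := by
  induction hy using AddSubgroup.closure_induction with
  | mem y hy =>
    obtain ⟨i, j, rfl, a, ha, v, hv, rfl⟩ := hy
    obtain ⟨t, ht, rfl⟩ := exists_piA_eq hconn hstrong ha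
    by_cases hj : j = 1
    · subst hj
      exact ⟨t * ι S (DegOne 𝒜) v, mul_ι_mem ht v, mul_ι_mem_augIdeal t v, cutA_mul_ι t v⟩
    · rw [degOneGrading, if_neg hj, Submodule.mem_bot] at hv
      exact ⟨0, zero_mem _, zero_mem _, by rw [hv, tmul_zero, map_zero]⟩
  | zero => exact ⟨0, zero_mem _, zero_mem _, map_zero _⟩
  | add x y _ _ hx hy =>
    obtain ⟨t, h1, h2, rfl⟩ := hx
    obtain ⟨t', h1', h2', rfl⟩ := hy
    exact ⟨t + t', add_mem h1 h1', add_mem h2 h2', map_add _ _ _⟩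
  | neg x _ hx =>
    obtain ⟨t, h1, h2, rfl⟩ := hx
    exact ⟨-t, neg_mem h1, neg_mem h2, map_neg _ _⟩

variable {α}

theorem cutA_fst_rightDeg {n : ℕ} {x} (hx : x ∈ α.rightDeg n) :
    x.1 ∈ augIdeal S (DegOne 𝒜) ∧ cutA 𝒜 x.1 = 0 := by
  induction hx using Submodule.span_induction with
  | mem x hx =>
    obtain ⟨m, rfl, y, hy, v, rfl⟩ := hx
    have : piA 𝒜 y.1 = 0 := fst_mem_relIdeal hR α hy
    rw [pairMul_apply, cutA_mul_ι, this, zero_tmul]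
    exact ⟨mul_ι_mem_augIdeal _ v, rfl⟩
  | zero => exact ⟨zero_mem _, map_zero _⟩
  | add x y _ _ hx hy =>
    exact ⟨add_mem hx.1 hy.1, by rw [Prod.fst_add, map_add, hx.2, hy.2, add_zero]⟩
  | smul s x _ hx =>
    exact ⟨(augIdeal S (DegOne 𝒜)).smul_mem (scalar S (DegOne 𝒜) s) hx.1, by
      rw [Prod.smul_fst, map_smul, hx.2, smul_zero]⟩

theorem cutA_fst_nullMod {x} (hx : x ∈ α.nullMod) :
    x.1 ∈ augIdeal S (DegOne 𝒜) ∧ cutA 𝒜 x.1 = 0 := by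
  obtain ⟨y, hy, z, ⟨hz, -⟩, rfl⟩ := Submodule.mem_sup.mp hx
  rw [Prod.fst_add, hz, add_zero]
  clear hx
  induction hy using Submodule.span_induction with
  | mem x hx =>
    obtain ⟨m, hm⟩ := Set.mem_iUnion.mp hx
    exact cutA_fst_rightDeg hR hm
  | zero => exact ⟨zero_mem _, map_zero _⟩
  | add x y _ _ hx hy =>
    exact ⟨add_mem hx.1 hy.1, by rw [Prod.fst_add, map_add, hx.2, hy.2, add_zero]⟩
  | smul t x _ hx =>
    exact ⟨(augIdeal S (DegOne 𝒜)).smul_mem t hx.1, by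
      rw [Prod.smul_fst, smul_eq_mul, cutA_mul _ hx.1, hx.2, smul_zero]⟩

theorem fst_leftDeg_mem_augIdeal (hconn : IsConnectedGrading 𝒜) {n : ℕ} {x}
    (hx : x ∈ α.leftDeg n) : x.1 ∈ augIdeal S (DegOne 𝒜) := by
  induction hx using Submodule.span_induction with
  | mem x hx =>
    obtain ⟨i, j, rfl, a, ha, r, hr, rfl⟩ := hx
    refine (augIdeal S (DegOne 𝒜)).smul_mem a ?_
    cases j with
    | zero =>
      rw [relation_eq_zero hR hconn hr, map_zero]
      exact zero_mem _
    | succ j => exact deg_succ_le_augIdeal hr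
  | zero => exact zero_mem _
  | add x y _ _ hx hy => exact add_mem hx hy
  | smul s x _ hx => exact (augIdeal S (DegOne 𝒜)).smul_mem (scalar S (DegOne 𝒜) s) hx

/-- An element of `ker d₁` lifts to a homogeneous element of `I_A`. Modulo `I_A A¹`, which `cutA`
kills, it is the leading part of a left combination of relations. -/
theorem exists_mem_leftDeg (hconn : IsConnectedGrading 𝒜) (hstrong : IsStronglyGraded 𝒜) {n : ℕ}
    {y : TensorOver S A (DegOne 𝒜)} (hy : y ∈ tensorDeg 𝒜 (degOneGrading 𝒜) n)
    (h : d₁ 𝒜 y = 0) : ∃ x ∈ α.leftDeg n, cutA 𝒜 x.1 = y := by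
  obtain ⟨t, h1, h2, rfl⟩ := exists_cutA_eq hconn hstrong hy
  rw [d₁_cutA h2] at h
  obtain ⟨x, hx, rfl⟩ := exists_mem_idealDeg hR α h h1
  obtain ⟨x', hx', x'', hx'', rfl⟩ := Submodule.mem_sup.mp (idealDeg_le n hx)
  refine ⟨x', hx', ?_⟩
  rw [Prod.fst_add, map_add, (cutA_fst_rightDeg hR hx'').2, add_zero]

/-- Each homogeneous component of `t` is the leading part of some `x` in the ideal of relations, to
which `smul_pair_mem_nullMod` applies. -/
theorem smul_pair_mem_nullMod_of_mem_relIdeal (hconn : IsConnectedGrading 𝒜) {t : TA 𝒜}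
    (ht : t ∈ relIdeal 𝒜) {j : ℕ} {r : R.toSubmodule} (hr : (r : TA 𝒜) ∈ deg S (DegOne 𝒜) j) :
    t • α.pair j r ∈ α.nullMod := by
  classical
  cases j with
  | zero => rw [relation_eq_zero hR hconn hr, map_zero, smul_zero]; exact zero_mem _
  | succ j =>
    rw [← DirectSum.sum_support_decompose (deg S (DegOne 𝒜)) t, Finset.sum_smul]
    refine sum_mem fun n _ => ?_
    obtain ⟨x, hx, h⟩ := exists_mem_idealDeg hR α (proj_mem_relIdeal n ht) (SetLike.coe_mem _)
    rw [GradedRing.proj_apply] at h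
    rw [← h]
    exact smul_pair_mem_nullMod hx hr

/-- An element of `T_A A¹` of degree `n` that vanishes in `A ⊗_S A¹` comes from `I_A A¹`. -/
theorem exists_mem_rightDeg [Module.Projective S (DegOne 𝒜)] {n : ℕ} {t : TA 𝒜}
    (ht : t ∈ deg S (DegOne 𝒜) (n + 1)) (h : cutA 𝒜 t = 0) : ∃ x ∈ α.rightDeg (n + 1), x.1 = t := by
  obtain ⟨c, hc⟩ := Module.projective_def'.mp
    (inferInstance : Module.Projective S (DegOne 𝒜))
  have ht' := deg_succ_le_augIdeal ht
  have key : ∀ v, ∃ x ∈ α.idealDeg n, x.1 = rightCoord c t v := fun v =>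
    exists_mem_idealDeg hR α (map_rightCoord c (piA 𝒜) piA_scalar ht' h v) (rightCoord_mem c ht v)
  choose x hx hxv using key
  refine ⟨(rightCoord c t).sum fun v _ => pairMul (ι S (DegOne 𝒜) v) (x v),
    sum_mem fun v _ => pairMul_ι_mem_rightDeg v (hx v), ?_⟩
  conv_rhs => rw [← sum_rightCoord (DFunLike.congr_fun hc) ht']
  rw [Finsupp.sum, Prod.fst_sum]
  exact Finset.sum_congr rfl fun v _ => by rw [pairMul_apply, hxv]

end relations

/-! ### Components of graded projective modules. -/

section internal

variable {S : Type u} {V : Type v} [Ring S] [AddCommGroup V] [Module S V]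
  {𝒱 : ℕ → Submodule S V}

theorem exists_projections (h : DirectSum.IsInternal 𝒱) : ∃ p : ℕ → V →ₗ[S] V,
    (∀ i j, ∀ v ∈ 𝒱 i, p j v = if i = j then v else 0) ∧ ∀ n v, p n v ∈ 𝒱 n := by
  let := h.chooseDecomposition
  refine ⟨fun n => (𝒱 n).subtype ∘ₗ DirectSum.component S ℕ (fun i => 𝒱 i) n ∘ₗ
    (DirectSum.decomposeLinearEquiv 𝒱).toLinearMap, fun i j v hv => ?_, fun n v => ?_⟩
  · change (DirectSum.decompose 𝒱 v j : V) = _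
    split_ifs with hij
    · subst hij
      exact DirectSum.decompose_of_mem_same _ hv
    · exact DirectSum.decompose_of_mem_ne _ hv hij
  · exact SetLike.coe_mem _

theorem projective_of_isInternal (h : DirectSum.IsInternal 𝒱) [Module.Projective S V] (n : ℕ) :
    Module.Projective S (𝒱 n) := by
  obtain ⟨p, hp, hp'⟩ := exists_projections h
  refine Module.Projective.of_split (𝒱 n).subtype ((p n).codRestrict (𝒱 n) (hp' n))
    (LinearMap.ext fun v => Subtype.ext ?_)
  change p n v = v
  rw [hp n n v v.2, if_pos rfl]

theorem exists_linearMap_of_isInternal (h : DirectSum.IsInternal 𝒱) {M : Type w} [AddCommGroup M]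
    [Module S M] (f : ∀ n, 𝒱 n →ₗ[S] M) : ∃ g : V →ₗ[S] M, ∀ n (v : 𝒱 n), g v = f n v := by
  let := h.chooseDecomposition
  refine ⟨DirectSum.toModule S ℕ M f ∘ₗ (DirectSum.decomposeLinearEquiv 𝒱).toLinearMap,
    fun n v => ?_⟩
  change DirectSum.toModule S ℕ M f (DirectSum.decompose 𝒱 (v : V)) = _
  rw [DirectSum.decompose_coe]
  exact DirectSum.toModule_lof (M := fun i => 𝒱 i) S n v

end internal

/-! ### The module of relations and its map to `A ⊗_S A¹`. -/

section comparison

variable {S : Type u} {A : Type v} [Ring S] [Ring A] [Module S A] [IsScalarTower S A A]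
  {𝒜 : ℕ → Submodule S A} [GradedRing 𝒜]

open TensorRing Polynomial

omit [IsScalarTower S A A] [GradedRing 𝒜] in
theorem degOneGrading_projections (i j : ℕ) (v : DegOne 𝒜) (hv : v ∈ degOneGrading 𝒜 i) :
    (if j = 1 then LinearMap.id else 0 : DegOne 𝒜 →ₗ[S] DegOne 𝒜) v =
      if i = j then v else 0 := by
  rw [degOneGrading] at hv
  by_cases hi : i = 1
  · subst hi
    by_cases hj : j = 1
    · simp [hj]
    · simp [hj, Ne.symm hj]
  · rw [if_neg hi, Submodule.mem_bot] at hv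
    simp [hv]

variable {R : GradedSubbimodule S (DegOne 𝒜)} (α : FilteredMap R)

/-- The module that receives the classes of the relations. -/
abbrev FilteredMap.RelMod : Type _ := (TA 𝒜 × (TA 𝒜)[X]) ⧸ α.nullMod

/-- The classes of the relations of degree `n`. -/
noncomputable def FilteredMap.relDeg (n : ℕ) : Submodule S α.RelMod :=
  (α.leftDeg n).map (α.nullMod.mkQ.restrictScalars S)

variable (hR : IsBimoduleOfRelations 𝒜 R)

/-- The map from `RelMod` to `A ⊗_S A¹` that is induced by `cutA`. -/
noncomputable def FilteredMap.relCut : α.RelMod →ₗ[S] TensorOver S A (DegOne 𝒜) :=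
  (Submodule.liftQ (α.nullMod.restrictScalars S) (cutA 𝒜 ∘ₗ LinearMap.fst S _ _)
    (fun _ hx => (cutA_fst_nullMod hR hx).2)) ∘ₗ
    (Submodule.Quotient.restrictScalarsEquiv S α.nullMod).symm.toLinearMap

theorem relCut_mk (x : TA 𝒜 × (TA 𝒜)[X]) : α.relCut hR (Submodule.Quotient.mk x) = cutA 𝒜 x.1 :=
  rfl

variable {α}

theorem mk_mem_relDeg {n : ℕ} {x} (hx : x ∈ α.leftDeg n) :
    (Submodule.Quotient.mk x : α.RelMod) ∈ α.relDeg n := ⟨x, hx, rfl⟩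

theorem smul_mem_relDeg {i n : ℕ} {t : TA 𝒜} (ht : t ∈ deg S (DegOne 𝒜) i) {m : α.RelMod}
    (hm : m ∈ α.relDeg n) : t • m ∈ α.relDeg (i + n) := by
  obtain ⟨x, hx, rfl⟩ := hm
  exact ⟨t • x, smul_mem_leftDeg ht hx, rfl⟩

include hR

theorem relCut_smul (hconn : IsConnectedGrading 𝒜) {n : ℕ} (t : TA 𝒜) {m : α.RelMod}
    (hm : m ∈ α.relDeg n) : α.relCut hR (t • m) = piA 𝒜 t • α.relCut hR m := by
  obtain ⟨x, hx, rfl⟩ := hm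
  exact cutA_mul t (fst_leftDeg_mem_augIdeal hR hconn hx)

/-- This lets `A = T_A / I_A` act on the classes of left relations, as needed to extend a map from
`V₂` to `A ⊗_S V₂`. -/
theorem relIdeal_smul (hconn : IsConnectedGrading 𝒜) {n : ℕ} {t : TA 𝒜} (ht : t ∈ relIdeal 𝒜)
    {m : α.RelMod} (hm : m ∈ α.relDeg n) : t • m = 0 := by
  obtain ⟨x, hx, rfl⟩ := hm
  change (Submodule.Quotient.mk (t • x) : α.RelMod) = 0
  rw [Submodule.Quotient.mk_eq_zero]
  suffices ∀ t ∈ relIdeal 𝒜, t • x ∈ α.nullMod from this t ht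
  clear ht t
  induction hx using Submodule.span_induction with
  | mem x hx =>
    obtain ⟨i, j, h, a, ha, r, hr, rfl⟩ := hx
    intro t ht
    rw [smul_smul]
    exact smul_pair_mem_nullMod_of_mem_relIdeal hR hconn (mul_mem_relIdeal_right a ht) hr
  | zero => simp
  | add x y _ _ hx hy => intro t ht; rw [smul_add]; exact add_mem (hx t ht) (hy t ht)
  | smul s x _ hx =>
    intro t ht
    have : t • s • x = (t * scalar S (DegOne 𝒜) s) • x := by
      rw [mul_smul, ← smul_one_smul (TA 𝒜) s x, TensorRing.smul_def, mul_one]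
    rw [this]
    exact hx _ (mul_mem_relIdeal_right _ ht)

omit hR in
/-- The additive map `A ⊗_S W → M` given by an `S`-linear map from `W` to a `T_A`-module `M` whose
image is annihilated by `I_A`. -/
theorem exists_liftAdd (hconn : IsConnectedGrading 𝒜) (hstrong : IsStronglyGraded 𝒜)
    {W : Type w} [AddCommGroup W] [Module S W] {M : Type w'} [AddCommGroup M] [Module S M]
    [Module (TA 𝒜) M] [IsScalarTower S (TA 𝒜) M] (f : W →ₗ[S] M)
    (hf : ∀ t ∈ relIdeal 𝒜, ∀ w, t • f w = 0) :
    ∃ g : TensorOver S A W →+ M, ∀ t w, g (tmul S (piA 𝒜 t) w) = t • f w := by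
  let h : TA 𝒜 →+ W →+ M :=
    { toFun := fun t => (DistribSMul.toAddMonoidHom M t).comp f.toAddMonoidHom
      map_zero' := by ext w; simp
      map_add' := fun t t' => by ext w; simp [add_smul] }
  have hs : Function.Surjective (piA 𝒜).toAddMonoidHom := piA_surjective hconn hstrong
  let k : A →+ W →+ M := (piA 𝒜).toAddMonoidHom.liftOfSurjective hs
    ⟨h, fun t ht => AddMonoidHom.ext fun w => hf t ht w⟩
  have hk : ∀ t w, k (piA 𝒜 t) w = t • f w := fun t w =>
    DFunLike.congr_fun ((piA 𝒜).toAddMonoidHom.liftOfRightInverse_comp_apply _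
      (Function.rightInverse_surjInv hs) ⟨h, fun t ht => AddMonoidHom.ext fun w => hf t ht w⟩ t) w
  refine ⟨TensorOver.liftAdd k fun a s w => ?_, fun t w => by rw [TensorOver.liftAdd_tmul, hk]⟩
  obtain ⟨t, rfl⟩ := piA_surjective hconn hstrong a
  rw [← piA_scalar (𝒜 := 𝒜), ← map_mul, hk, hk, mul_smul, map_smul, ← smul_one_smul (TA 𝒜) s (f w),
    TensorRing.smul_def, mul_one]

omit hR in
theorem deg_succ_le_closure_mul_ι {V : Type w} [AddCommGroup V] [Module S V] [Module Sᵐᵒᵖ V]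
    {n : ℕ} {t : TensorRing S V} (ht : t ∈ deg S V (n + 1)) :
    t ∈ AddSubgroup.closure {x | ∃ y ∈ deg S V n, ∃ v : V, x = y * ι S V v} := by
  rw [deg] at ht
  suffices ∀ s : S, s • t ∈
      AddSubgroup.closure {x | ∃ y ∈ deg S V n, ∃ v : V, x = y * ι S V v} by
    simpa using this 1
  induction ht using Submodule.span_induction with
  | mem x hx =>
    obtain ⟨t, ht, v, rfl⟩ := hx
    intro s
    rw [← smul_mul_assoc]
    exact AddSubgroup.subset_closure ⟨_, Submodule.smul_mem _ s ht, v, rfl⟩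
  | zero => simp
  | add x y _ _ hx hy => intro s; rw [smul_add]; exact add_mem (hx s) (hy s)
  | smul s x _ hx => intro s'; rw [smul_smul]; exact hx _

omit hR in
-- By definition `Tⁿ⁺¹ = Tⁿ V`; here the factor from `V` is moved to the left end of the word.
theorem deg_succ_le_closure {V : Type w} [AddCommGroup V] [Module S V] [Module Sᵐᵒᵖ V] {n : ℕ}
    {t : TensorRing S V} (ht : t ∈ deg S V (n + 1)) :
    t ∈ AddSubgroup.closure {x | ∃ v : V, ∃ y ∈ deg S V n, x = ι S V v * y} := by
  induction n generalizing t with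
  | zero =>
    refine (AddSubgroup.closure_le _).mpr ?_ (deg_succ_le_closure_mul_ι ht)
    rintro _ ⟨t, ht, v, rfl⟩
    obtain ⟨s, rfl⟩ := Submodule.mem_span_singleton.mp ht
    refine AddSubgroup.subset_closure ⟨s • v, 1, SetLike.GradedOne.one_mem, ?_⟩
    rw [smul_mul_assoc, one_mul, mul_one, map_smul]
  | succ n ih =>
    refine (AddSubgroup.closure_le _).mpr ?_ (deg_succ_le_closure_mul_ι ht)
    rintro _ ⟨t, ht, v, rfl⟩
    rw [SetLike.mem_coe]
    replace ht := ih ht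
    induction ht using AddSubgroup.closure_induction with
    | mem x hx =>
      obtain ⟨w, y, hy, rfl⟩ := hx
      exact AddSubgroup.subset_closure ⟨w, y * ι S V v, mul_ι_mem hy v, mul_assoc _ _ _⟩
    | zero => simp
    | add x y _ _ hx hy => rw [add_mul]; exact add_mem hx hy
    | neg x _ hx => rw [neg_mul]; exact neg_mem hx

omit hR in
/-- A left relation of degree `n + 1` is the sum of an element of `R`
and of products of elements of `A¹` and left relations of degree `n`. -/
theorem mem_leftDeg_succ {n : ℕ} {x} (hx : x ∈ α.leftDeg (n + 1)) :
    ∃ r : R.toSubmodule, (r : TA 𝒜) ∈ deg S (DegOne 𝒜) (n + 1) ∧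
      ∃ y ∈ AddSubgroup.closure {y | ∃ v : DegOne 𝒜, ∃ z ∈ α.leftDeg n, y = ι S (DegOne 𝒜) v • z},
        x = α.pair (n + 1) r + y := by
  suffices ∀ s : S, ∃ r : R.toSubmodule, (r : TA 𝒜) ∈ deg S (DegOne 𝒜) (n + 1) ∧
      ∃ y ∈ AddSubgroup.closure {y | ∃ v : DegOne 𝒜, ∃ z ∈ α.leftDeg n, y = ι S (DegOne 𝒜) v • z},
        s • x = α.pair (n + 1) r + y by
    simpa using this 1
  induction hx using Submodule.span_induction with
  | mem x hx =>
    obtain ⟨i, j, hij, a, ha, r, hr, rfl⟩ := hx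
    intro s
    cases i with
    | zero =>
      obtain rfl : j = n + 1 := by omega
      obtain ⟨s', rfl⟩ := Submodule.mem_span_singleton.mp ha
      refine ⟨s • s' • r, Submodule.smul_mem _ _ (Submodule.smul_mem _ _ hr), 0, zero_mem _, ?_⟩
      rw [add_zero, map_smul, map_smul, smul_assoc, one_smul]
    | succ i =>
      refine ⟨0, zero_mem _, s • a • α.pair j r, ?_, by rw [map_zero, zero_add]⟩
      rw [← smul_assoc]
      have := deg_succ_le_closure (Submodule.smul_mem _ s ha)
      generalize s • a = b at this
      induction this using AddSubgroup.closure_induction with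
      | mem x hx =>
        obtain ⟨v, y, hy, rfl⟩ := hx
        refine AddSubgroup.subset_closure ⟨v, y • α.pair j r, ?_, mul_smul _ _ _⟩
        exact Submodule.subset_span ⟨i, j, by omega, y, hy, r, hr, rfl⟩
      | zero => simp
      | add x y _ _ hx hy => rw [add_smul]; exact add_mem hx hy
      | neg x _ hx => rw [neg_smul]; exact neg_mem hx
  | zero => exact fun s => ⟨0, zero_mem _, 0, zero_mem _, by simp⟩
  | add x x' _ _ hx hx' =>
    intro s
    obtain ⟨r, hr, y, hy, h⟩ := hx s
    obtain ⟨r', hr', y', hy', h'⟩ := hx' s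
    refine ⟨r + r', add_mem hr hr', y + y', add_mem hy hy', ?_⟩
    rw [smul_add, h, h', map_add]
    abel
  | smul s x _ hx => intro s'; rw [smul_smul]; exact hx _

theorem leftDeg_zero (hconn : IsConnectedGrading 𝒜) {x} (hx : x ∈ α.leftDeg 0) : x = 0 := by
  induction hx using Submodule.span_induction with
  | mem x hx =>
    obtain ⟨i, j, hij, a, ha, r, hr, rfl⟩ := hx
    obtain rfl : j = 0 := by omega
    rw [relation_eq_zero hR hconn hr, map_zero, smul_zero]
  | zero => rfl
  | add x y _ _ hx hy => rw [hx, hy, add_zero]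
  | smul s x _ hx => rw [hx, smul_zero]

/-- Minimality of the relations. -/
theorem mem_closure_of_cutA_eq_zero
    [Module.Projective S (DegOne 𝒜)] {n : ℕ} {x} (hx : x ∈ α.leftDeg (n + 1))
    (h : cutA 𝒜 x.1 = 0) :
    x ∈ AddSubgroup.closure {y | ∃ v : DegOne 𝒜, ∃ z ∈ α.leftDeg n, y = ι S (DegOne 𝒜) v • z} := by
  obtain ⟨r, hr, y, hy, rfl⟩ := mem_leftDeg_succ hx
  -- The kernel of `cutA` in this degree is contained in `I_A A¹`, and the leading part of `y` lies
  -- in `A¹ I_A`. Hence `r` lies in `R ∩ (A¹ I_A + I_A A¹) = 0`.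
  have h1 : (α.pair (n + 1) r + y).1 ∈ relIdealTilde 𝒜 := by
    obtain ⟨z, hz, hz'⟩ := exists_mem_rightDeg hR (α := α)
      (fst_mem_of_mem_idealDeg (leftDeg_le_idealDeg _ hx)) h
    rw [← hz']
    refine Submodule.mem_sup_right ?_
    clear hz' h
    induction hz using Submodule.span_induction with
    | mem x hx =>
      obtain ⟨m, hm, y, hy, v, rfl⟩ := hx
      exact Submodule.subset_span ⟨v, y.1, fst_mem_relIdeal hR α hy, rfl⟩
    | zero => exact zero_mem _
    | add x y _ _ hx hy => exact add_mem hx hy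
    | smul s x _ hx => exact Submodule.smul_mem _ s hx
  have h2 : y.1 ∈ relIdealTilde 𝒜 := by
    refine Submodule.mem_sup_left ?_
    clear h1 h hx
    induction hy using AddSubgroup.closure_induction with
    | mem y hy =>
      obtain ⟨v, z, hz, rfl⟩ := hy
      exact Submodule.subset_span
        ⟨v, z.1, fst_mem_relIdeal hR α (leftDeg_le_idealDeg _ hz), rfl⟩
    | zero => exact zero_mem _
    | add x y _ _ hx hy => exact add_mem hx hy
    | neg x _ hx => exact neg_mem hx
  have h3 : (r : TA 𝒜) ∈ relIdealTilde 𝒜 := by simpa [FilteredMap.pair_apply] using sub_mem h1 h2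
  have h4 : (r : TA 𝒜) ∈ (⊥ : Submodule S (TA 𝒜)) := hR.1 ▸ ⟨r.2, h3⟩
  obtain rfl : r = 0 := Subtype.ext h4
  rwa [map_zero, zero_add]

/-- If relations of degree `n` are divisible then `relCut` is injective in degree `n`. -/
theorem eq_zero_of_relCut_eq_zero (hconn : IsConnectedGrading 𝒜)
    [Module.Projective S (DegOne 𝒜)] {n : ℕ} (hdiv : α.IsDivisible n) {m : α.RelMod}
    (hm : m ∈ α.relDeg n) (h : α.relCut hR m = 0) : m = 0 := by
  obtain ⟨x, hx, rfl⟩ := hm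
  change cutA 𝒜 x.1 = 0 at h
  change (Submodule.Quotient.mk x : α.RelMod) = 0
  cases n with
  | zero => rw [leftDeg_zero hR hconn hx, Submodule.Quotient.mk_zero]
  | succ n =>
    rw [Submodule.Quotient.mk_eq_zero]
    obtain ⟨y, hy, hyx⟩ := exists_mem_rightDeg hR (α := α)
      (fst_mem_of_mem_idealDeg (leftDeg_le_idealDeg _ hx)) h
    -- `x` and `y` have the same leading part, so their difference has the form to which
    -- divisibility applies.
    have h1 : x - y ∈ α.idealDeg (n + 1) :=
      sub_mem (leftDeg_le_idealDeg _ hx) (rightDeg_le_idealDeg _ hy)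
    have h2 : (x - y).1 = 0 := by rw [Prod.fst_sub, hyx, sub_self]
    obtain ⟨j, hj, h3⟩ := hdiv (x - y).2 (by rw [← h2]; exact h1)
    have := add_mem (mem_nullMod_of_eq_X_mul h2 hj h3) (mem_nullMod_of_mem_rightDeg hy)
    rwa [sub_add_cancel] at this

theorem isDivisible_zero (hconn : IsConnectedGrading 𝒜) : α.IsDivisible 0 := by
  intro q hq
  have : ((0 : TA 𝒜), q) = 0 := by
    refine idealDeg_induction (p := fun x => x = 0) rfl (fun x y hx hy => by rw [hx, hy, add_zero])
      ?_ hq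
    intro i j k h a ha r hr b hb
    obtain rfl : j = 0 := by omega
    rw [relation_eq_zero hR hconn hr, map_zero, smul_zero, map_zero]
  exact ⟨0, zero_mem _, by simpa using congrArg Prod.snd this⟩

/-- If relations of degree `n` are divisible and `relCut` is injective in degree `n + 1`, then
relations of degree `n + 1` are divisible. -/
theorem isDivisible_succ [Module.Projective S (DegOne 𝒜)] {n : ℕ} (hdiv : α.IsDivisible n)
    (h : ∀ m ∈ α.relDeg (n + 1), α.relCut hR m = 0 → m = 0) : α.IsDivisible (n + 1) := by
  intro q hq
  obtain ⟨x, hx, y, hy, hxy⟩ := Submodule.mem_sup.mp (idealDeg_le _ hq)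
  have h1 : cutA 𝒜 x.1 = 0 := by
    have : x.1 + y.1 = 0 := congrArg Prod.fst hxy
    rw [eq_neg_of_add_eq_zero_left this, map_neg, (cutA_fst_rightDeg hR hy).2, neg_zero]
  have h2 : x ∈ α.nullMod := by
    rw [← Submodule.Quotient.mk_eq_zero]
    exact h _ (mk_mem_relDeg hx) h1
  refine hdiv.of_mem_nullMod (snd_mem_of_mem_idealDeg hq) ?_
  rw [← hxy]
  exact add_mem h2 (mem_nullMod_of_mem_rightDeg hy)

end comparison

/-! ### Comparison of the relations with the resolution. -/

section resolution

variable {S : Type u} {A : Type v} [Ring S] [Ring A] [Module S A] [IsScalarTower S A A]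
  {𝒜 : ℕ → Submodule S A} [GradedRing 𝒜]

open TensorRing Polynomial

variable (res : Resolution.{u, v, w} 𝒜)

theorem Resolution.exists_d₂_eq {n : ℕ} {y : TensorOver S A (DegOne 𝒜)}
    (hy : y ∈ tensorDeg 𝒜 (degOneGrading 𝒜) n) (h : d₁ 𝒜 y = 0) :
    ∃ x ∈ tensorDeg 𝒜 (res.grading 0) n, res.d₂ x = y := by
  obtain ⟨x, rfl⟩ := (res.exact₁ y).mp h
  obtain ⟨x', hx', h'⟩ := exists_mem_of_mem_iSup res.d₂.toAddMonoidHom res.d₂_graded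
    (q := tensorProj 𝒜 (fun j => if j = 1 then LinearMap.id else 0) n) (n := n)
    (fun m y hy => tensorProj_of_mem degOneGrading_projections n hy) (x := x)
    (by rw [iSup_tensorDeg (res.isInternal 0).submodule_iSup_eq_top]; trivial)
  refine ⟨x', hx', h'.trans ((tensorProj_of_mem degOneGrading_projections n hy).trans ?_)⟩
  exact if_pos rfl

theorem Resolution.exists_d_eq {n : ℕ} {y : TensorOver S A (res.V 0)}
    (hy : y ∈ tensorDeg 𝒜 (res.grading 0) n) (h : res.d₂ y = 0) :
    ∃ x ∈ tensorDeg 𝒜 (res.grading 1) n, res.d 0 x = y := by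
  obtain ⟨x, rfl⟩ := (res.exact₂ y).mp h
  obtain ⟨p, hp, -⟩ := exists_projections (res.isInternal 0)
  obtain ⟨x', hx', h'⟩ := exists_mem_of_mem_iSup (res.d 0).toAddMonoidHom (res.d_graded 0)
    (q := tensorProj 𝒜 p n) (n := n) (fun m y hy => tensorProj_of_mem hp n hy) (x := x)
    (by rw [iSup_tensorDeg (res.isInternal 1).submodule_iSup_eq_top]; trivial)
  refine ⟨x', hx', h'.trans ((tensorProj_of_mem hp n hy).trans ?_)⟩
  exact if_pos rfl

omit [GradedRing 𝒜] in
-- A nonzero component in degree `n + 1` would contribute `(n + 1) - 1 = n` to the supremum defining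
-- `c₃`.
theorem Resolution.grading_eq_bot_of_lt {n : ℕ} (h : ¬ (n : EReal) ≤ res.c₃) :
    res.grading 1 (n + 1) = ⊥ := by
  rw [Resolution.c₃, complexity] at h
  split_ifs at h with hs
  · exact Subsingleton.elim _ _
  · by_contra hn
    refine h (le_sSup ⟨n + 1, hn, ?_⟩)
    push_cast
    exact (EReal.add_sub_cancel_right (a := (n : EReal)) (b := 1)).symm

variable {R : GradedSubbimodule S (DegOne 𝒜)} {α : FilteredMap R}
  (hR : IsBimoduleOfRelations 𝒜 R) (hconn : IsConnectedGrading 𝒜)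
  (hstrong : IsStronglyGraded 𝒜)

include hconn hstrong in
/-- The comparison of a resolution with the relations: lifting `d₂` along `relCut`. -/
theorem exists_comparison :
    ∃ f : TensorOver S A (res.V 0) →+ α.RelMod,
      (∀ t x, f (piA 𝒜 t • x) = t • f x) ∧
      (∀ n, ∀ x ∈ tensorDeg 𝒜 (res.grading 0) n, f x ∈ α.relDeg n) ∧
      ∀ x, α.relCut hR (f x) = res.d₂ x := by
  have hproj := res.projective 0
  have hlift : ∀ n, ∃ f : res.grading 0 n →ₗ[S] α.RelMod, ∀ v, f v ∈ α.relDeg n ∧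
      α.relCut hR (f v) = res.d₂ (tmul S 1 (v : res.V 0)) := by
    intro n
    have := projective_of_isInternal (res.isInternal 0) n
    -- The lifting is done one degree at a time, so that the lift of `V₂ⁿ` lands in `relDeg n`. It
    -- exists because `d₁ ∘ d₂ = 0` puts `d₂(1 ⊗ v)` in the range of `μ`.
    let μ : α.relDeg n →ₗ[S] TensorOver S A (DegOne 𝒜) := (α.relCut hR).domRestrict (α.relDeg n)
    let e : res.grading 0 n →ₗ[S] TensorOver S A (DegOne 𝒜) :=
      { toFun := fun v => res.d₂ (tmul S 1 (v : res.V 0))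
        map_add' := fun v w => by rw [Submodule.coe_add, tmul_add, map_add]
        map_smul' := fun s v => by
          rw [Submodule.coe_smul, ← smul_tmul_one, LinearMap.map_smul_of_tower, RingHom.id_apply] }
    have he : ∀ v, e v ∈ LinearMap.range μ := by
      intro v
      have h1 : e v ∈ tensorDeg 𝒜 (degOneGrading 𝒜) n :=
        res.d₂_graded n _ (tmul_mem_tensorDeg (zero_add n) SetLike.GradedOne.one_mem v.2)
      obtain ⟨x, hx, h⟩ := exists_mem_leftDeg hR (α := α) hconn hstrong h1
        (res.exact₁.apply_apply_eq_zero _)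
      exact ⟨⟨_, mk_mem_relDeg hx⟩, h⟩
    obtain ⟨g, hg⟩ := Module.projective_lifting_property μ.rangeRestrict (e.codRestrict _ he)
      μ.surjective_rangeRestrict
    refine ⟨(α.relDeg n).subtype ∘ₗ g, fun v => ⟨(g v).2, ?_⟩⟩
    exact congrArg Subtype.val (DFunLike.congr_fun hg v)
  choose f hf using hlift
  obtain ⟨f₀, hf₀⟩ := exists_linearMap_of_isInternal (res.isInternal 0) f
  have hv : ∀ v : res.V 0, v ∈ ⨆ n, res.grading 0 n := fun v =>
    (res.isInternal 0).submodule_iSup_eq_top ▸ Submodule.mem_top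
  obtain ⟨g, hg⟩ := exists_liftAdd hconn hstrong f₀ (fun t ht v => by
    have := hv v
    induction this using Submodule.iSup_induction' with
    | mem n v hn => rw [hf₀ n ⟨v, hn⟩]; exact relIdeal_smul hR hconn ht (hf n _).1
    | zero => rw [map_zero, smul_zero]
    | add v w _ _ hv hw => rw [map_add, smul_add, hv, hw, add_zero])
  refine ⟨g, fun t x => ?_, fun n x hx => ?_, fun x => ?_⟩
  · induction x using TensorOver.induction with
    | h0 => simp
    | ht a v =>
      obtain ⟨t', rfl⟩ := piA_surjective hconn hstrong a
      rw [smul_tmul, ← map_mul, hg, hg, mul_smul]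
    | ha x y hx hy => rw [smul_add, map_add, map_add, smul_add, hx, hy]
  · induction hx using AddSubgroup.closure_induction with
    | mem x hx =>
      obtain ⟨i, j, rfl, a, ha, v, hv, rfl⟩ := hx
      obtain ⟨t, ht, rfl⟩ := exists_piA_eq hconn hstrong ha
      rw [hg, hf₀ j ⟨v, hv⟩]
      exact smul_mem_relDeg ht (hf j _).1
    | zero => rw [map_zero]; exact zero_mem _
    | add x y _ _ hx hy => rw [map_add]; exact add_mem hx hy
    | neg x _ hx => rw [map_neg]; exact neg_mem hx
  · induction x using TensorOver.induction with
    | h0 => simp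
    | ht a v =>
      obtain ⟨t, rfl⟩ := piA_surjective hconn hstrong a
      have := hv v
      induction this using Submodule.iSup_induction' with
      | mem n v hn =>
        rw [hg, hf₀ n ⟨v, hn⟩, relCut_smul hR hconn t (hf n _).1, (hf n _).2, ← map_smul,
          smul_tmul, mul_one]
      | zero => rw [tmul_zero, map_zero, map_zero, map_zero]
      | add v w _ _ hv hw => rw [tmul_add, map_add, map_add, map_add, hv, hw]
    | ha x y hx hy => rw [map_add, map_add, map_add, hx, hy]

section
variable {res} {f : TensorOver S A (res.V 0) →+ α.RelMod}
  (hf₁ : ∀ t x, f (piA 𝒜 t • x) = t • f x)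
  (hf₂ : ∀ n, ∀ x ∈ tensorDeg 𝒜 (res.grading 0) n, f x ∈ α.relDeg n)
  (hf₃ : ∀ x, α.relCut hR (f x) = res.d₂ x)

include hconn hf₁ hf₂ hf₃ in
/-- The comparison map is surjective. -/
theorem exists_comparison_eq [Module.Projective S (DegOne 𝒜)] {n : ℕ}
    {m : α.RelMod} (hm : m ∈ α.relDeg n) : ∃ x ∈ tensorDeg 𝒜 (res.grading 0) n, f x = m := by
  induction n generalizing m with
  | zero =>
    obtain ⟨x, hx, rfl⟩ := hm
    rw [leftDeg_zero hR hconn hx, map_zero]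
    exact ⟨0, zero_mem _, map_zero _⟩
  | succ n ih =>
    obtain ⟨x, hx, rfl⟩ := hm
    have h1 : d₁ 𝒜 (cutA 𝒜 x.1) = 0 := by
      rw [d₁_cutA (fst_leftDeg_mem_augIdeal hR hconn hx)]
      exact fst_mem_relIdeal hR α (leftDeg_le_idealDeg _ hx)
    obtain ⟨p, hp, hpx⟩ := res.exists_d₂_eq
      (cutA_mem (fst_mem_of_mem_idealDeg (leftDeg_le_idealDeg _ hx))) h1
    obtain ⟨y, hy, hyp⟩ := hf₂ _ p hp
    replace hyp : (Submodule.Quotient.mk y : α.RelMod) = f p := hyp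
    -- Correcting `x` by a representative `y` of `f p` makes `cutA` vanish. By minimality of `R` the
    -- rest is then a sum of products of `A¹` with left relations of degree `n`, covered by
    -- induction.
    have h2 : cutA 𝒜 (x - y).1 = 0 := by
      have := hf₃ p
      rw [← hyp, relCut_mk] at this
      rw [Prod.fst_sub, map_sub, this, hpx, sub_self]
    have h3 := mem_closure_of_cutA_eq_zero hR (sub_mem hx hy) h2
    have key : ∀ z ∈ AddSubgroup.closure
        {y | ∃ v : DegOne 𝒜, ∃ z ∈ α.leftDeg n, y = ι S (DegOne 𝒜) v • z},
        ∃ q ∈ tensorDeg 𝒜 (res.grading 0) (n + 1), f q = Submodule.Quotient.mk z := by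
      intro z hz
      induction hz using AddSubgroup.closure_induction with
      | mem z hz =>
        obtain ⟨v, z, hz, rfl⟩ := hz
        obtain ⟨q, hq, hqz⟩ := ih (mk_mem_relDeg hz)
        refine ⟨piA 𝒜 (ι S (DegOne 𝒜) v) • q, ?_, ?_⟩
        · rw [add_comm]
          exact smul_mem_tensorDeg (piA_mem (ι_mem v)) hq
        · rw [hf₁, hqz, Submodule.Quotient.mk_smul]
      | zero => exact ⟨0, zero_mem _, by simp⟩
      | add z z' _ _ hz hz' =>
        obtain ⟨q, hq, h⟩ := hz
        obtain ⟨q', hq', h'⟩ := hz'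
        exact ⟨q + q', add_mem hq hq', by rw [map_add, h, h', Submodule.Quotient.mk_add]⟩
      | neg z _ hz =>
        obtain ⟨q, hq, h⟩ := hz
        exact ⟨-q, neg_mem hq, by rw [map_neg, h, Submodule.Quotient.mk_neg]⟩
    obtain ⟨q, hq, hqx⟩ := key _ h3
    refine ⟨p + q, add_mem hp hq, ?_⟩
    rw [map_add, hqx, ← hyp, ← Submodule.Quotient.mk_add, add_sub_cancel]
    rfl

end

include hR hconn hstrong in
-- The homological step. A class killed by `relCut` is `f (d₃ u)`, and `u` is a sum of terms `a u'`
-- with `a ∈ A¹` and `u'` of degree `n`. Since `relCut (f (d₃ u')) = d₂ (d₃ u') = 0`, divisibility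
-- in degree `n` already forces `f (d₃ u') = 0`.
theorem isDivisible_succ_of_grading_eq_bot [Module.Projective S (DegOne 𝒜)] {n : ℕ}
    (hdiv : α.IsDivisible n) (h : res.grading 1 (n + 1) = ⊥) : α.IsDivisible (n + 1) := by
  obtain ⟨f, hf₁, hf₂, hf₃⟩ := exists_comparison res (α := α) hR hconn hstrong
  refine isDivisible_succ hR hdiv fun m hm hm0 => ?_
  obtain ⟨x, hx, rfl⟩ := exists_comparison_eq hR hconn hf₁ hf₂ hf₃ hm
  rw [hf₃] at hm0
  obtain ⟨u, hu, rfl⟩ := res.exists_d_eq hx hm0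
  clear hm hm0 hx
  replace hu := tensorDeg_succ_le hstrong h hu
  induction hu using AddSubgroup.closure_induction with
  | mem u hu =>
    obtain ⟨a, ha, u, hu, rfl⟩ := hu
    obtain ⟨t, -, rfl⟩ := exists_piA_eq hconn hstrong ha
    have h1 := res.d_graded 0 n u hu
    rw [map_smul, hf₁, eq_zero_of_relCut_eq_zero hR hconn hdiv (hf₂ _ _ h1), smul_zero]
    rw [hf₃]
    exact res.exact₂.apply_apply_eq_zero u
  | zero => simp
  | add u u' _ _ hu hu' => rw [map_add, map_add, hu, hu', add_zero]
  | neg u _ hu => rw [map_neg, map_neg, hu, neg_zero]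

end resolution

end SRing

theorem mainTheorem6 {S : Type*} {A : Type*} [Ring S] [Ring A] [Module S A]
    [IsScalarTower S A A] (𝒜 : ℕ → Submodule S A) [GradedRing 𝒜]
    (hconn : SRing.IsConnectedGrading 𝒜) (hstrong : SRing.IsStronglyGraded 𝒜)
    (hA₁ : Module.Projective S (SRing.DegOne 𝒜))
    (R : SRing.GradedSubbimodule S (SRing.DegOne 𝒜)) (hR : SRing.IsBimoduleOfRelations 𝒜 R)
    (hRproj : Module.Projective S R.toSubmodule) (α : SRing.FilteredMap R)
    (res : SRing.Resolution 𝒜) :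
    IsRegular α.z ↔ res.c₃ = -1 ∨ α.IsRegularUpTo res.c₃ := by
  refine ⟨fun h => Or.inr (SRing.isRegularUpTo_of_isRegular h _), fun h => ?_⟩
  have hreg : α.IsRegularUpTo res.c₃ := by
    rcases h with h | h
    -- No natural number is at most `-1`, so the condition is vacuous for `c₃ = -1`.
    · intro n hn
      rw [h] at hn
      have : (0 : EReal) ≤ -1 := le_trans (by exact_mod_cast n.zero_le) hn
      exact absurd this (by norm_num)
    · exact h
  refine SRing.isRegular_z fun n => ?_
  induction n with
  | zero => exact SRing.isDivisible_zero hR hconn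
  | succ n ih =>
    -- Up to `c₃` the regularity hypothesis supplies the step; beyond it `V₃ⁿ⁺¹ = 0` and the
    -- resolution does.
    by_cases hn : (n : EReal) ≤ res.c₃
    · exact hreg.isDivisible hn
    · exact SRing.isDivisible_succ_of_grading_eq_bot res hR hconn hstrong ih
        (res.grading_eq_bot_of_lt hn)
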